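/- Every rational number $x\in[0,1]$ has a unique finite odd continued fraction $$x=1+\cfrac{\varepsilon_1}{a_1+\cfrac{\varepsilon_2}{a_2+\ldots+\cfrac{\varepsilon_l}{a_l}}},$$ where $l\ge 0$, the $a_j$ are odd positive integers, $\varepsilon_j=\pm1$, $\varepsilon_1=-1$, $a_j+\varepsilon_{j+1}\ge 2$ for $1\le j<l$, and $\varepsilon_l=1$ if $l\ge2$ and $a_l=1$ (the case $l=0$ is $x=1$). Put $S(x)=\sum_{j=1}^{l}a_j$, $\mathcal M_n=\{x\in\mathbb Q\cap[0,1]: S(x)\le n+1\}$, and $$F_n(x)=\frac{\#\{\xi\in\mathcal M_n:\xi\le x\}}{\#\mathcal M_n},\qquad F(x)=\lim_{n\to\infty}F_n(x).$$ Theorem 3. The limit $F(x)$ exists for every $x\in[0,1]$. If at a point $x\in[0,1]$ the derivative $F'(x)$ exists, finite or infinite (one-sided if $x=0$ or $x=1$), then $F'(x)=0$ or $F'(x)=+\infty$. Consequently $F$ is a singular function on $[0,1]$: it is monotone, continuous and not constant, and $F'(x)=0$ for almost every $x\in[0,1]$ with respect to Lebesgue measure. -/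

import Mathlib

open Set Filter Topology MeasureTheory

/-- The value `ε₁ / (a₁ + ε₂ / (a₂ + … + ε_l / a_l))` of a finite list of pairs `(ε_j, a_j)`;
the empty list has the value `0`. -/
def oddTail : List (ℤ × ℕ) → ℚ
  | [] => 0
  | t :: l => (t.1 : ℚ) / ((t.2 : ℚ) + oddTail l)

/-- The value `[1; ε₁/a₁, …, ε_l/a_l] = 1 + ε₁ / (a₁ + ε₂ / (a₂ + … + ε_l / a_l))`. -/
def oddValue (l : List (ℤ × ℕ)) : ℚ := 1 + oddTail l

/-- The list of pairs `(ε_j, a_j)` is the list of a (finite) odd continued fraction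
`[1; ε₁/a₁, …, ε_l/a_l]`. The last clause makes the representation of a rational number unique;
it concerns fractions with at least two partial quotients, since `0 = [1; -1/1]`
has no other representation. (The empty list represents `1`.) -/
structure IsOddCF (l : List (ℤ × ℕ)) : Prop where
  /-- `ε_j = ±1` -/
  sign : ∀ t ∈ l, t.1 = 1 ∨ t.1 = -1
  /-- every `a_j` is odd -/
  odd : ∀ t ∈ l, Odd t.2
  /-- `ε₁ = -1` -/
  head : ∀ t ∈ l.head?, t.1 = -1
  /-- `a_j + ε_{j+1} ≥ 2` -/
  chain : l.IsChain (fun s t => 2 ≤ (s.2 : ℤ) + t.1)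
  /-- if the last partial quotient is `1`, then its numerator is `1` -/
  last : 2 ≤ l.length → ∀ t ∈ l.getLast?, t.2 = 1 → t.1 = 1

/-- The sum `a₁ + … + a_l` of the partial quotients. -/
def oddSum (l : List (ℤ × ℕ)) : ℕ := (l.map Prod.snd).sum

/-- The set `M_n` of the rational numbers in `[0,1]` whose odd continued fraction has sum of
partial quotients at most `n + 1`. -/
def oddM (n : ℕ) : Set ℚ :=
  {x | 0 ≤ x ∧ x ≤ 1 ∧ ∃ l, IsOddCF l ∧ oddValue l = x ∧ oddSum l ≤ n + 1}

/-- The distribution function `F_n` of the set `M_n`. -/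
noncomputable def oddDistrib (n : ℕ) (x : ℝ) : ℝ :=
  ({ξ : ℚ | ξ ∈ oddM n ∧ (ξ : ℝ) ≤ x}.ncard : ℝ) / ((oddM n).ncard : ℝ)

/-- The limit distribution function `F` of the sets `M_n`. -/
noncomputable def oddF (x : ℝ) : ℝ := limUnder atTop (fun n : ℕ => oddDistrib n x)

/-- `f` has at `x`, relative to `s`, the finite or infinite derivative `d`. -/
def HasExtDerivWithinAt (f : ℝ → ℝ) (d : EReal) (s : Set ℝ) (x : ℝ) : Prop :=
  Tendsto (fun y => ((slope f x y : ℝ) : EReal)) (𝓝[s \ {x}] x) (𝓝 d)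

/-- `f` is a singular function on `[a, b]`: monotone, continuous, not constant, with derivative
`0` almost everywhere. -/
structure IsSingularOn (f : ℝ → ℝ) (a b : ℝ) : Prop where
  monotone : MonotoneOn f (Icc a b)
  continuous : ContinuousOn f (Icc a b)
  lt : f a < f b
  deriv : ∀ᵐ x ∂(volume.restrict (Icc a b)), HasDerivWithinAt f 0 (Icc a b) x


/-!
In the coordinate `Y = 1 / (1 - x)` an odd continued fraction is built by the three operations
`Y ↦ 1 + 1 / Y`, `Y ↦ 3 - 1 / Y` and `Y ↦ Y + 2`, which raise the sum of the partial quotients by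
`1`, `3` and `2`. They map `[0, 1]` onto `[0, 1/2]`, `[1/2, 2/3]` and `[2/3, 1]`. If points on a
jump are counted half, the counting functions of the sets `M_n` satisfy exact recursions along these
branches. Scaled by `z ^ n`, where `z + z ^ 2 + z ^ 3 = 1`, they converge geometrically, and the
limit `F` is self-similar: the branches carry the masses `z`, `z ^ 3` and `z ^ 2`.

A composition of branches maps `[0, 1]` onto an interval of length `1 / (s * t)`, where `s` and `t`
are the denominators of its end points. If `F` had a finite derivative `d ≠ 0` at `x`, the mean
slopes of `F` over the nested intervals around `x` would tend to `|d|`, so that consecutive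
quotients would tend to `1`. Such a quotient is a function of the branch and of the ratio `s / t`.
It is close to `1` only for `s / t` in two short intervals, and the branch then moves `s / t` out
of both, so two consecutive quotients are never close to `1`.
-/

section BranchMaps

variable {K : Type*} [Field K]

/-- The decreasing branch, of `[0, 1]` onto `[0, 1/2]`. In the coordinate `Y` with `x = 1 - 1 / Y`
it is `Y ↦ 1 + 1 / Y`, which prepends `a = 1` followed by the sign `+1`. -/
def leftMap (x : K) : K := (1 - x) / (2 - x)

/-- The increasing branch of `[0, 1]` onto `[1/2, 2/3]`. In the coordinate `Y` with `x = 1 - 1 / Y`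
it is `Y ↦ 3 - 1 / Y`, which prepends `a = 3` followed by the sign `-1`. -/
def midMap (x : K) : K := (1 + x) / (2 + x)

/-- The increasing branch of `[0, 1]` onto `[2/3, 1]`. In the coordinate `Y` with `x = 1 - 1 / Y`
it is `Y ↦ Y + 2`, which adds `2` to the first partial quotient. -/
def rightMap (x : K) : K := (2 - x) / (3 - 2 * x)

theorem cast_leftMap (x : ℚ) : ((leftMap x : ℚ) : ℝ) = leftMap (x : ℝ) := by
  simp [leftMap]

theorem cast_midMap (x : ℚ) : ((midMap x : ℚ) : ℝ) = midMap (x : ℝ) := by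
  simp [midMap]

theorem cast_rightMap (x : ℚ) : ((rightMap x : ℚ) : ℝ) = rightMap (x : ℝ) := by
  simp [rightMap]

theorem leftMap_zero : leftMap (0 : K) = 1 / 2 := by norm_num [leftMap]

theorem leftMap_one : leftMap (1 : K) = 0 := by norm_num [leftMap]

theorem midMap_zero : midMap (0 : K) = 1 / 2 := by norm_num [midMap]

theorem midMap_one : midMap (1 : K) = 2 / 3 := by norm_num [midMap]

theorem rightMap_zero : rightMap (0 : K) = 2 / 3 := by norm_num [rightMap]

theorem rightMap_one : rightMap (1 : K) = 1 := by norm_num [rightMap]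

variable [LinearOrder K] [IsStrictOrderedRing K] {x Y : K}

theorem leftMap_one_sub_inv (hY : 0 < Y) : leftMap (1 - Y⁻¹) = 1 - (1 + Y⁻¹)⁻¹ := by
  have : 0 < Y + 1 := by linarith
  have h₁ : 2 - (1 - Y⁻¹) = (Y + 1) / Y := by field_simp; ring
  have h₂ : 1 + Y⁻¹ = (Y + 1) / Y := by field_simp
  rw [leftMap, h₁, h₂]
  field_simp
  ring

theorem midMap_one_sub_inv (hY : 1 ≤ Y) : midMap (1 - Y⁻¹) = 1 - (3 - Y⁻¹)⁻¹ := by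
  have : 0 < Y := by linarith
  have hY' : 3 * Y - 1 ≠ 0 := by linarith
  have h₁ : 2 + (1 - Y⁻¹) = (3 * Y - 1) / Y := by field_simp; ring
  have h₂ : 3 - Y⁻¹ = (3 * Y - 1) / Y := by field_simp
  rw [midMap, h₁, h₂, inv_div, eq_sub_iff_add_eq, div_div_eq_mul_div, ← add_div,
    div_eq_one_iff_eq hY']
  field_simp
  ring

theorem rightMap_one_sub_inv (hY : 0 < Y) : rightMap (1 - Y⁻¹) = 1 - (Y + 2)⁻¹ := by
  have h : 3 - 2 * (1 - Y⁻¹) = (Y + 2) / Y := by field_simp; ring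
  rw [rightMap, h]
  field_simp
  ring

theorem strictAntiOn_leftMap : StrictAntiOn leftMap (Iic (1 : K)) := fun x hx y hy hxy => by
  rw [mem_Iic] at hx hy
  rw [leftMap, leftMap, div_lt_div_iff₀ (by linarith) (by linarith)]
  linarith

theorem strictMonoOn_midMap : StrictMonoOn midMap (Ici (0 : K)) := fun x hx y hy hxy => by
  rw [mem_Ici] at hx hy
  rw [midMap, midMap, div_lt_div_iff₀ (by linarith) (by linarith)]
  linarith

theorem strictMonoOn_rightMap : StrictMonoOn rightMap (Iic (1 : K)) := fun x hx y hy hxy => by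
  rw [mem_Iic] at hx hy
  rw [rightMap, rightMap, div_lt_div_iff₀ (by linarith) (by linarith)]
  linarith

theorem leftMap_mem_Icc (hx : x ∈ Icc 0 1) : leftMap x ∈ Icc 0 (1 / 2) :=
  ⟨leftMap_one.symm.trans_le (strictAntiOn_leftMap.antitoneOn hx.2 self_mem_Iic hx.2),
    (strictAntiOn_leftMap.antitoneOn (mem_Iic.2 zero_le_one) hx.2 hx.1).trans_eq leftMap_zero⟩

theorem midMap_mem_Icc (hx : x ∈ Icc 0 1) : midMap x ∈ Icc (1 / 2) (2 / 3) :=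
  ⟨midMap_zero.symm.trans_le (strictMonoOn_midMap.monotoneOn self_mem_Ici hx.1 hx.1),
    (strictMonoOn_midMap.monotoneOn hx.1 (mem_Ici.2 zero_le_one) hx.2).trans_eq midMap_one⟩

theorem rightMap_mem_Icc (hx : x ∈ Icc 0 1) : rightMap x ∈ Icc (2 / 3) 1 :=
  ⟨rightMap_zero.symm.trans_le
      (strictMonoOn_rightMap.monotoneOn (mem_Iic.2 zero_le_one) hx.2 hx.1),
    (strictMonoOn_rightMap.monotoneOn hx.2 self_mem_Iic hx.2).trans_eq rightMap_one⟩

theorem leftMap_lt_half (hx : 0 < x) (hx' : x ≤ 1) : leftMap x < 1 / 2 :=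
  (strictAntiOn_leftMap (mem_Iic.2 zero_le_one) hx' hx).trans_eq leftMap_zero

theorem half_lt_midMap (hx : 0 < x) : 1 / 2 < midMap x :=
  midMap_zero.symm.trans_lt (strictMonoOn_midMap self_mem_Ici hx.le hx)

theorem midMap_lt_two_thirds (hx : 0 ≤ x) (hx' : x < 1) : midMap x < 2 / 3 :=
  (strictMonoOn_midMap hx (mem_Ici.2 zero_le_one) hx').trans_eq midMap_one

theorem two_thirds_lt_rightMap (hx : 0 < x) (hx' : x ≤ 1) : 2 / 3 < rightMap x :=
  rightMap_zero.symm.trans_lt (strictMonoOn_rightMap (mem_Iic.2 zero_le_one) hx' hx)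

theorem mapsTo_leftMap : MapsTo leftMap (Icc (0 : K) 1) (Icc 0 1) := fun _ hx =>
  Icc_subset_Icc le_rfl (by norm_num) (leftMap_mem_Icc hx)

theorem mapsTo_midMap : MapsTo midMap (Icc (0 : K) 1) (Icc 0 1) := fun _ hx =>
  Icc_subset_Icc (by norm_num) (by norm_num) (midMap_mem_Icc hx)

theorem mapsTo_rightMap : MapsTo rightMap (Icc (0 : K) 1) (Icc 0 1) := fun _ hx =>
  Icc_subset_Icc (by norm_num) le_rfl (rightMap_mem_Icc hx)

end BranchMaps

theorem exists_eq_branch {x : ℝ} (hx : x ∈ Icc (0 : ℝ) 1) :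
    ∃ y ∈ Icc (0 : ℝ) 1, x = leftMap y ∨ x = midMap y ∨ x = rightMap y := by
  rcases le_total x (1 / 2) with h | h
  · have hc : ContinuousOn leftMap (Icc (0 : ℝ) 1) :=
      ContinuousOn.div (by fun_prop) (by fun_prop) fun y hy => by linarith [hy.2]
    obtain ⟨y, hy, rfl⟩ := intermediate_value_Icc' zero_le_one hc
      (show x ∈ Icc _ _ by rw [leftMap_zero, leftMap_one]; exact ⟨hx.1, h⟩)
    exact ⟨y, hy, .inl rfl⟩
  rcases le_total x (2 / 3) with h' | h'
  · have hc : ContinuousOn midMap (Icc (0 : ℝ) 1) :=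
      ContinuousOn.div (by fun_prop) (by fun_prop) fun y hy => by linarith [hy.1]
    obtain ⟨y, hy, rfl⟩ := intermediate_value_Icc zero_le_one hc
      (show x ∈ Icc _ _ by rw [midMap_zero, midMap_one]; exact ⟨h, h'⟩)
    exact ⟨y, hy, .inr (.inl rfl)⟩
  · have hc : ContinuousOn rightMap (Icc (0 : ℝ) 1) :=
      ContinuousOn.div (by fun_prop) (by fun_prop) fun y hy => by linarith [hy.2]
    obtain ⟨y, hy, rfl⟩ := intermediate_value_Icc zero_le_one hc
      (show x ∈ Icc _ _ by rw [rightMap_zero, rightMap_one]; exact ⟨h', hx.2⟩)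
    exact ⟨y, hy, .inr (.inr rfl)⟩

/-! ### Odd continued fractions and the branches -/

theorem isOddCF_nil : IsOddCF [] := by constructor <;> simp

theorem isOddCF_singleton {ε : ℤ} {a : ℕ} : IsOddCF [(ε, a)] ↔ ε = -1 ∧ Odd a := by
  constructor
  · exact fun h => ⟨h.head _ rfl, h.odd (ε, a) (by simp)⟩
  · rintro ⟨rfl, ha⟩
    constructor <;> simp [ha]

theorem isOddCF_cons_cons {ε δ : ℤ} {a b : ℕ} {r : List (ℤ × ℕ)} :
    IsOddCF ((ε, a) :: (δ, b) :: r) ↔ ε = -1 ∧ Odd a ∧ (δ = 1 ∨ δ = -1) ∧ 2 ≤ (a : ℤ) + δ ∧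
      (r = [] → b = 1 → δ = 1) ∧ IsOddCF ((-1, b) :: r) := by
  constructor
  · intro h
    have hsign := h.sign
    have hodd := h.odd
    have hchain := h.chain
    have hlast := h.last
    simp only [List.mem_cons, forall_eq_or_imp, List.isChain_cons_cons] at hsign hodd hchain
    refine ⟨h.head _ rfl, hodd.1, hsign.2.1, hchain.1, ?_, ?_, ?_, by simp, ?_, ?_⟩
    · rintro rfl
      simpa using hlast
    · simpa using hsign.2.2
    · simpa using hodd.2
    · cases r <;> simp_all
    · cases r <;> simp_all
  · rintro ⟨rfl, ha, hδ, haδ, hb, hsign, hodd, -, hchain, hlast⟩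
    simp only [List.mem_cons, forall_eq_or_imp] at hsign hodd
    constructor
    · simpa [hδ] using hsign.2
    · simpa [ha, hodd.1] using hodd.2
    · simp
    · cases r <;> simp_all
    · cases r <;> simp_all

theorem IsOddCF.one_le_add_oddTail {ε : ℤ} {a : ℕ} {r : List (ℤ × ℕ)}
    (h : IsOddCF ((ε, a) :: r)) : 1 ≤ (a : ℚ) + oddTail r := by
  induction r generalizing ε a with
  | nil => simpa [oddTail, Nat.one_le_iff_ne_zero] using (isOddCF_singleton.1 h).2.pos.ne'
  | cons t r ih =>
    obtain ⟨δ, b⟩ := t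
    obtain ⟨-, ha, hδ, haδ, -, h'⟩ := isOddCF_cons_cons.1 h
    have hY := ih h'
    have hY_pos : 0 < (b + oddTail r)⁻¹ := by positivity
    have hY_le : (b + oddTail r)⁻¹ ≤ 1 := inv_le_one_of_one_le₀ hY
    have ha' : (1 : ℚ) ≤ a := by exact_mod_cast ha.pos
    have haδ' : (2 : ℚ) ≤ a + δ := by exact_mod_cast haδ
    simp only [oddTail, div_eq_mul_inv]
    rcases hδ with rfl | rfl
    · push_cast
      linarith
    · push_cast at haδ' ⊢
      linarith

theorem oddValue_neg_one_cons (a : ℕ) (r : List (ℤ × ℕ)) :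
    oddValue ((-1, a) :: r) = 1 - ((a : ℚ) + oddTail r)⁻¹ := by
  simp [oddValue, oddTail, neg_div, sub_eq_add_neg]

theorem IsOddCF.eq_nil_or_eq_cons {l : List (ℤ × ℕ)} (h : IsOddCF l) :
    l = [] ∨ ∃ a r, l = (-1, a) :: r := by
  rcases l with _ | ⟨⟨ε, a⟩, r⟩
  · exact .inl rfl
  · obtain rfl : ε = -1 := h.head _ rfl
    exact .inr ⟨a, r, rfl⟩

theorem IsOddCF.oddValue_mem_Icc {l : List (ℤ × ℕ)} (h : IsOddCF l) :
    oddValue l ∈ Icc (0 : ℚ) 1 := by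
  obtain rfl | ⟨a, r, rfl⟩ := h.eq_nil_or_eq_cons
  · simp [oddValue, oddTail]
  · have hY := h.one_le_add_oddTail
    rw [oddValue_neg_one_cons]
    exact ⟨sub_nonneg.2 (inv_le_one_of_one_le₀ hY), sub_le_self _ (by positivity)⟩

/-- The rational numbers with an odd continued fraction of sum at most `m`: the set `M_n` with the
index shifted so that the branches raise it by `1`, `3` and `2`, starting from `m = 0`. -/
def oddLevel (m : ℕ) : Set ℚ := {x | ∃ l, IsOddCF l ∧ oddValue l = x ∧ oddSum l ≤ m}

theorem oddM_eq_oddLevel (n : ℕ) : oddM n = oddLevel (n + 1) := by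
  ext x
  constructor
  · rintro ⟨_, _, h⟩
    exact h
  · rintro ⟨l, h, rfl, hs⟩
    exact ⟨h.oddValue_mem_Icc.1, h.oddValue_mem_Icc.2, l, h, rfl, hs⟩

theorem one_mem_oddLevel (m : ℕ) : 1 ∈ oddLevel m :=
  ⟨[], isOddCF_nil, by simp [oddValue, oddTail], by simp [oddSum]⟩

theorem zero_mem_oddLevel (m : ℕ) : 0 ∈ oddLevel (m + 1) :=
  ⟨[(-1, 1)], isOddCF_singleton.2 ⟨rfl, odd_one⟩, by simp [oddValue, oddTail], by simp [oddSum]⟩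

theorem mem_oddLevel_iff {m : ℕ} {x : ℚ} : x ∈ oddLevel m ↔ x = 1 ∨
    ∃ a r, IsOddCF ((-1, a) :: r) ∧ a + oddSum r ≤ m ∧ x = 1 - ((a : ℚ) + oddTail r)⁻¹ := by
  constructor
  · rintro ⟨l, h, rfl, hs⟩
    obtain rfl | ⟨a, r, rfl⟩ := h.eq_nil_or_eq_cons
    · simp [oddValue, oddTail]
    · exact .inr ⟨a, r, h, by simpa [oddSum] using hs, oddValue_neg_one_cons a r⟩
  · rintro (rfl | ⟨a, r, h, hs, rfl⟩)
    · exact one_mem_oddLevel m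
    · exact ⟨_, h, oddValue_neg_one_cons a r, by simpa [oddSum] using hs⟩

theorem leftMap_mem_oddLevel {m : ℕ} {x : ℚ} (hx : x ∈ oddLevel m) :
    leftMap x ∈ oddLevel (m + 1) := by
  obtain rfl | ⟨a, r, h, hs, rfl⟩ := mem_oddLevel_iff.1 hx
  · rw [leftMap_one]
    exact zero_mem_oddLevel m
  · have hY := h.one_le_add_oddTail
    refine mem_oddLevel_iff.2 (.inr ⟨1, (1, a) :: r, ?_, ?_, ?_⟩)
    · simp [isOddCF_cons_cons, h]
    · simp only [oddSum, List.map_cons, List.sum_cons] at hs ⊢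
      omega
    · rw [leftMap_one_sub_inv (by positivity)]
      simp [oddTail]

theorem midMap_mem_oddLevel {m : ℕ} {x : ℚ} (hx : x ∈ oddLevel m) :
    midMap x ∈ oddLevel (m + 3) := by
  obtain rfl | ⟨a, r, h, hs, rfl⟩ := mem_oddLevel_iff.1 hx
  · refine mem_oddLevel_iff.2 (.inr ⟨3, [], isOddCF_singleton.2 ⟨rfl, by decide⟩, ?_, ?_⟩)
    · simp [oddSum]
    · norm_num [midMap, oddTail]
  by_cases hra : r = [] ∧ a = 1
  -- Here `x = 0`, and prepending `a = 3` with sign `-1` would violate the last clause of `IsOddCF`.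
  · obtain ⟨rfl, rfl⟩ := hra
    have hx : midMap (1 - ((1 : ℕ) + oddTail [])⁻¹ : ℚ) = leftMap 0 := by
      norm_num [midMap, leftMap, oddTail]
    rw [hx]
    exact leftMap_mem_oddLevel (zero_mem_oddLevel (m + 1))
  · refine mem_oddLevel_iff.2 (.inr ⟨3, (-1, a) :: r, ?_, ?_, ?_⟩)
    · refine isOddCF_cons_cons.2 ⟨rfl, by decide, .inr rfl, by norm_num, ?_, h⟩
      exact fun hr ha => absurd ⟨hr, ha⟩ hra
    · simp only [oddSum, List.map_cons, List.sum_cons] at hs ⊢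
      omega
    · rw [midMap_one_sub_inv h.one_le_add_oddTail]
      simp [oddTail, neg_div, sub_eq_add_neg]

theorem IsOddCF.add_two {a : ℕ} {r : List (ℤ × ℕ)} (h : IsOddCF ((-1, a) :: r)) :
    IsOddCF ((-1, a + 2) :: r) := by
  rcases r with _ | ⟨⟨δ, b⟩, r⟩
  · exact isOddCF_singleton.2 ⟨rfl, (isOddCF_singleton.1 h).2.add_even even_two⟩
  · obtain ⟨-, ha, hδ, haδ, hb, h'⟩ := isOddCF_cons_cons.1 h
    exact isOddCF_cons_cons.2 ⟨rfl, ha.add_even even_two, hδ, by push_cast; omega, hb, h'⟩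

theorem rightMap_mem_oddLevel {m : ℕ} {x : ℚ} (hx : x ∈ oddLevel m) :
    rightMap x ∈ oddLevel (m + 2) := by
  obtain rfl | ⟨a, r, h, hs, rfl⟩ := mem_oddLevel_iff.1 hx
  · rw [rightMap_one]
    exact one_mem_oddLevel _
  · have hY := h.one_le_add_oddTail
    refine mem_oddLevel_iff.2 (.inr ⟨a + 2, r, h.add_two, by omega, ?_⟩)
    rw [rightMap_one_sub_inv (by positivity)]
    push_cast
    ring

theorem IsOddCF.cons_cases {a : ℕ} {r : List (ℤ × ℕ)} (h : IsOddCF ((-1, a) :: r)) :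
    (a = 1 ∧ r = []) ∨
    (∃ b r', IsOddCF ((-1, b) :: r') ∧ a = 1 ∧ r = (1, b) :: r') ∨
    (∃ b r', IsOddCF ((-1, b) :: r') ∧ a = 3 ∧ r = (-1, b) :: r') ∨
    (∃ b, IsOddCF ((-1, b) :: r) ∧ a = b + 2) := by
  rcases r with _ | ⟨⟨δ, b⟩, r⟩
  · obtain ⟨-, k, rfl⟩ := isOddCF_singleton.1 h
    rcases k with _ | k
    · exact .inl ⟨rfl, rfl⟩
    · exact .inr (.inr (.inr ⟨2 * k + 1, isOddCF_singleton.2 ⟨rfl, k, rfl⟩, rfl⟩))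
  · obtain ⟨-, ⟨k, rfl⟩, hδ, haδ, hb, h'⟩ := isOddCF_cons_cons.1 h
    right
    rcases k with _ | k
    · obtain rfl : δ = 1 := by omega
      exact .inl ⟨b, r, h', rfl, rfl⟩
    by_cases hk : k = 0 ∧ δ = -1
    · obtain ⟨rfl, rfl⟩ := hk
      exact .inr (.inl ⟨b, r, h', rfl, rfl⟩)
    · refine .inr (.inr ⟨2 * k + 1, isOddCF_cons_cons.2 ⟨rfl, ⟨k, rfl⟩, hδ, ?_, hb, h'⟩, by ring⟩)
      push_cast at haδ ⊢
      omega

theorem exists_eq_branch_of_mem_oddLevel {m : ℕ} {x : ℚ} (hx : x ∈ oddLevel m) :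
    x = 1 ∨ (∃ k y, k + 1 = m ∧ y ∈ oddLevel k ∧ leftMap y = x) ∨
      (∃ k y, k + 3 = m ∧ y ∈ oddLevel k ∧ midMap y = x) ∨
      (∃ k y, k + 2 = m ∧ y ∈ oddLevel k ∧ rightMap y = x) := by
  obtain rfl | ⟨a, r, h, hs, rfl⟩ := mem_oddLevel_iff.1 hx
  · exact .inl rfl
  right
  obtain ⟨rfl, rfl⟩ | ⟨b, r, hb, rfl, rfl⟩ | ⟨b, r, hb, rfl, rfl⟩ | ⟨b, hb, rfl⟩ := h.cons_cases
  · obtain ⟨k, rfl⟩ := exists_add_of_le hs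
    exact .inl ⟨k, 1, by simp [oddSum, add_comm], one_mem_oddLevel k, by simp [leftMap, oddTail]⟩
  all_goals have hY := hb.one_le_add_oddTail
  · simp only [oddSum, List.map_cons, List.sum_cons] at hs
    refine .inl ⟨m - 1, _, by omega,
      mem_oddLevel_iff.2 (.inr ⟨b, r, hb, by rw [oddSum]; omega, rfl⟩), ?_⟩
    rw [leftMap_one_sub_inv (by positivity)]
    simp [oddTail]
  · simp only [oddSum, List.map_cons, List.sum_cons] at hs
    refine .inr (.inl ⟨m - 3, _, by omega,
      mem_oddLevel_iff.2 (.inr ⟨b, r, hb, by rw [oddSum]; omega, rfl⟩), ?_⟩)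
    rw [midMap_one_sub_inv hY]
    simp [oddTail, neg_div, sub_eq_add_neg]
  · refine .inr (.inr ⟨m - 2, _, by omega,
      mem_oddLevel_iff.2 (.inr ⟨b, r, hb, by omega, rfl⟩), ?_⟩)
    rw [rightMap_one_sub_inv (by positivity)]
    push_cast
    ring

theorem finite_oddLevel (m : ℕ) : (oddLevel m).Finite := by
  induction m using Nat.strong_induction_on with
  | _ m ih =>
    have hfin : (insert 1 (⋃ k ∈ Iio m,
        (leftMap '' oddLevel k ∪ midMap '' oddLevel k ∪ rightMap '' oddLevel k))).Finite :=
      ((finite_Iio m).biUnion fun k hk =>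
        (((ih k hk).image _).union ((ih k hk).image _)).union ((ih k hk).image _)).insert 1
    refine hfin.subset fun x hx => ?_
    obtain h | ⟨k, y, hk, hy, rfl⟩ | ⟨k, y, hk, hy, rfl⟩ | ⟨k, y, hk, hy, rfl⟩ :=
      exists_eq_branch_of_mem_oddLevel hx
    · exact .inl h
    · exact .inr (mem_biUnion (show k < m by omega) (.inl (.inl ⟨y, hy, rfl⟩)))
    · exact .inr (mem_biUnion (show k < m by omega) (.inl (.inr ⟨y, hy, rfl⟩)))
    · exact .inr (mem_biUnion (show k < m by omega) (.inr ⟨y, hy, rfl⟩))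

theorem oddM_add_three (n : ℕ) :
    oddM (n + 3) = leftMap '' oddM (n + 2) ∪ midMap '' oddM n ∪ rightMap '' oddM (n + 1) := by
  simp only [oddM_eq_oddLevel]
  refine subset_antisymm (fun x hx => ?_) (union_subset (union_subset ?_ ?_) ?_)
  · obtain rfl | ⟨k, y, hk, hy, h⟩ | ⟨k, y, hk, hy, h⟩ | ⟨k, y, hk, hy, h⟩ :=
      exists_eq_branch_of_mem_oddLevel hx
    · exact .inr ⟨1, one_mem_oddLevel _, rightMap_one⟩
    · obtain rfl : k = n + 3 := by omega
      exact .inl (.inl ⟨y, hy, h⟩)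
    · obtain rfl : k = n + 1 := by omega
      exact .inl (.inr ⟨y, hy, h⟩)
    · obtain rfl : k = n + 2 := by omega
      exact .inr ⟨y, hy, h⟩
  · exact image_subset_iff.2 fun x hx => leftMap_mem_oddLevel hx
  · exact image_subset_iff.2 fun x hx => midMap_mem_oddLevel hx
  · exact image_subset_iff.2 fun x hx => rightMap_mem_oddLevel hx

theorem finite_oddM (n : ℕ) : (oddM n).Finite :=
  oddM_eq_oddLevel n ▸ finite_oddLevel (n + 1)

/-- The set `M_n` as a finset, over which the counts below are sums. -/
noncomputable def oddFinset (n : ℕ) : Finset ℚ := (finite_oddM n).toFinset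

theorem mem_oddFinset {n : ℕ} {x : ℚ} : x ∈ oddFinset n ↔ x ∈ oddM n :=
  Finite.mem_toFinset _

theorem mem_Icc_of_mem_oddFinset {n : ℕ} {x : ℚ} (hx : x ∈ oddFinset n) : x ∈ Icc (0 : ℚ) 1 :=
  ⟨(mem_oddFinset.1 hx).1, (mem_oddFinset.1 hx).2.1⟩

theorem zero_mem_oddFinset (n : ℕ) : 0 ∈ oddFinset n :=
  mem_oddFinset.2 (oddM_eq_oddLevel n ▸ zero_mem_oddLevel n)

theorem one_mem_oddFinset (n : ℕ) : 1 ∈ oddFinset n :=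
  mem_oddFinset.2 (oddM_eq_oddLevel n ▸ one_mem_oddLevel (n + 1))

theorem oddFinset_add_three (n : ℕ) :
    oddFinset (n + 3) = (oddFinset (n + 2)).image leftMap ∪ (oddFinset n).image midMap ∪
      (oddFinset (n + 1)).image rightMap := by
  rw [← Finset.coe_inj]
  simpa only [oddFinset, Finite.coe_toFinset, Finset.coe_union, Finset.coe_image] using
    oddM_add_three n

theorem image_leftMap_inter_image_midMap (m n : ℕ) :
    (oddFinset m).image leftMap ∩ (oddFinset n).image midMap = {1 / 2} := by
  ext y
  simp only [Finset.mem_inter, Finset.mem_image, Finset.mem_singleton]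
  constructor
  · rintro ⟨⟨a, ha, rfl⟩, b, hb, hab⟩
    exact (leftMap_mem_Icc (mem_Icc_of_mem_oddFinset ha)).2.antisymm
      (hab ▸ (midMap_mem_Icc (mem_Icc_of_mem_oddFinset hb)).1)
  · rintro rfl
    exact ⟨⟨0, zero_mem_oddFinset m, leftMap_zero⟩, 0, zero_mem_oddFinset n, midMap_zero⟩

theorem image_leftMap_union_image_midMap_inter_image_rightMap (l m n : ℕ) :
    ((oddFinset l).image leftMap ∪ (oddFinset m).image midMap) ∩
      (oddFinset n).image rightMap = {2 / 3} := by
  ext y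
  simp only [Finset.mem_inter, Finset.mem_union, Finset.mem_image, Finset.mem_singleton]
  constructor
  · rintro ⟨⟨a, ha, rfl⟩ | ⟨a, ha, rfl⟩, b, hb, hab⟩
    · have h₁ := (leftMap_mem_Icc (mem_Icc_of_mem_oddFinset ha)).2
      have h₂ := (rightMap_mem_Icc (mem_Icc_of_mem_oddFinset hb)).1
      linarith
    · exact (midMap_mem_Icc (mem_Icc_of_mem_oddFinset ha)).2.antisymm
        (hab ▸ (rightMap_mem_Icc (mem_Icc_of_mem_oddFinset hb)).1)
  · rintro rfl
    exact ⟨.inr ⟨1, one_mem_oddFinset m, midMap_one⟩, 0, zero_mem_oddFinset n, rightMap_zero⟩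

theorem sum_oddFinset_add_three (n : ℕ) (f : ℝ → ℝ) :
    ∑ ξ ∈ oddFinset (n + 3), f ξ = ∑ ξ ∈ oddFinset (n + 2), f (leftMap (ξ : ℝ)) +
      ∑ ξ ∈ oddFinset n, f (midMap (ξ : ℝ)) + ∑ ξ ∈ oddFinset (n + 1), f (rightMap (ξ : ℝ)) -
      f (1 / 2) - f (2 / 3) := by
  have hleft : ∑ ξ ∈ (oddFinset (n + 2)).image leftMap, f ξ =
      ∑ ξ ∈ oddFinset (n + 2), f (leftMap (ξ : ℝ)) := by
    simp only [← cast_leftMap]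
    exact Finset.sum_image fun x hx y hy h => strictAntiOn_leftMap.injOn
      (mem_Icc_of_mem_oddFinset hx).2 (mem_Icc_of_mem_oddFinset hy).2 h
  have hmid : ∑ ξ ∈ (oddFinset n).image midMap, f ξ =
      ∑ ξ ∈ oddFinset n, f (midMap (ξ : ℝ)) := by
    simp only [← cast_midMap]
    exact Finset.sum_image fun x hx y hy h => strictMonoOn_midMap.injOn
      (mem_Icc_of_mem_oddFinset hx).1 (mem_Icc_of_mem_oddFinset hy).1 h
  have hright : ∑ ξ ∈ (oddFinset (n + 1)).image rightMap, f ξ =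
      ∑ ξ ∈ oddFinset (n + 1), f (rightMap (ξ : ℝ)) := by
    simp only [← cast_rightMap]
    exact Finset.sum_image fun x hx y hy h => strictMonoOn_rightMap.injOn
      (mem_Icc_of_mem_oddFinset hx).2 (mem_Icc_of_mem_oddFinset hy).2 h
  have h₁ := Finset.sum_union_inter (f := fun ξ : ℚ => f ξ)
    (s₁ := (oddFinset (n + 2)).image leftMap) (s₂ := (oddFinset n).image midMap)
  have h₂ := Finset.sum_union_inter (f := fun ξ : ℚ => f ξ)
    (s₁ := (oddFinset (n + 2)).image leftMap ∪ (oddFinset n).image midMap)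
    (s₂ := (oddFinset (n + 1)).image rightMap)
  rw [image_leftMap_inter_image_midMap, Finset.sum_singleton, hleft, hmid] at h₁
  rw [image_leftMap_union_image_midMap_inter_image_rightMap, Finset.sum_singleton, hright,
    ← oddFinset_add_three] at h₂
  push_cast at h₁ h₂
  linarith

/-! ### Symmetric counting functions -/

section Jump

variable {α β : Type*} [LinearOrder α] [LinearOrder β] {f : α → β} {s : Set α} {x y : α}

/-- Twice the indicator of `y ≤ x`, averaged at the jump: `0`, `1`, `2` according as `x < y`,
`x = y`, `y < x`. The averaging lets a decreasing map act by `c ↦ 2 - c`, without error terms. -/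
def jump (x y : α) : ℝ := (if y < x then 1 else 0) + (if y ≤ x then 1 else 0)

theorem jump_of_lt (h : x < y) : jump x y = 0 := by
  simp [jump, h.not_ge, h.not_gt]

theorem jump_of_gt (h : y < x) : jump x y = 2 := by
  norm_num [jump, h, h.le]

theorem jump_self (x : α) : jump x x = 1 := by
  simp [jump]

theorem monotone_jump (y : α) : Monotone (jump · y) := fun a b hab => by
  have h₁ : y < a → y < b := fun h => h.trans_le hab
  have h₂ : y ≤ a → y ≤ b := fun h => h.trans hab
  dsimp only [jump]
  gcongr <;> split_ifs <;> simp_all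

theorem jump_map_of_strictMonoOn (hf : StrictMonoOn f s) (hx : x ∈ s) (hy : y ∈ s) :
    jump (f x) (f y) = jump x y := by
  simp [jump, hf.lt_iff_lt hy hx, hf.le_iff_le hy hx]

theorem jump_map_of_strictAntiOn (hf : StrictAntiOn f s) (hx : x ∈ s) (hy : y ∈ s) :
    jump (f x) (f y) = 2 - jump x y := by
  obtain h | rfl | h := lt_trichotomy x y
  · rw [jump_of_gt (hf hx hy h), jump_of_lt h, sub_zero]
  · norm_num [jump_self]
  · rw [jump_of_lt (hf hy hx h), jump_of_gt h, sub_self]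

end Jump

theorem sum_eq_add_of_forall_ne_eq {ι : Type*} {s : Finset ι} {p : ι} {f : ι → ℝ} {c : ℝ}
    (hp : p ∈ s) (h : ∀ i ∈ s, i ≠ p → f i = c) : ∑ i ∈ s, f i = c * (s.card - 1) + f p := by
  classical
  rw [← Finset.sum_erase_add _ _ hp, Finset.sum_congr rfl fun i hi =>
    h i (Finset.mem_of_mem_erase hi) (Finset.ne_of_mem_erase hi), Finset.sum_const,
    Finset.card_erase_of_mem hp, nsmul_eq_mul, Nat.cast_pred (Finset.card_pos.2 ⟨p, hp⟩), mul_comm]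

/-- The symmetric count `#{ξ ∈ M_n : ξ < x} + #{ξ ∈ M_n : ξ ≤ x} - 1`. Unlike the number of
`ξ ≤ x` it satisfies the branch recursions exactly, also on `M_n`, and vanishes at `0`. -/
noncomputable def oddCount (n : ℕ) (x : ℝ) : ℝ := ∑ ξ ∈ oddFinset n, jump x (ξ : ℝ) - 1

theorem monotone_oddCount (n : ℕ) : Monotone (oddCount n) := fun _ _ hxy => by
  unfold oddCount
  gcongr with ξ
  exact monotone_jump _ hxy

theorem oddCount_zero (n : ℕ) : oddCount n 0 = 0 := by
  rw [oddCount, sum_eq_add_of_forall_ne_eq (c := 0) (zero_mem_oddFinset n), Rat.cast_zero,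
    jump_self]
  · ring
  · intro ξ hξ hne
    exact jump_of_lt (by exact_mod_cast (mem_Icc_of_mem_oddFinset hξ).1.lt_of_ne' hne)

theorem oddCount_one (n : ℕ) : oddCount n 1 = 2 * ((oddFinset n).card - 1) := by
  rw [oddCount, sum_eq_add_of_forall_ne_eq (c := 2) (one_mem_oddFinset n), Rat.cast_one,
    jump_self]
  · ring
  · intro ξ hξ hne
    exact jump_of_gt (by exact_mod_cast (mem_Icc_of_mem_oddFinset hξ).2.lt_of_ne hne)

theorem oddCount_one_pos (n : ℕ) : 0 < oddCount n 1 := by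
  have h : 1 < (oddFinset n).card :=
    Finset.one_lt_card.2 ⟨0, zero_mem_oddFinset n, 1, one_mem_oddFinset n, zero_ne_one⟩
  rw [oddCount_one]
  have h' : (1 : ℝ) < (oddFinset n).card := by exact_mod_cast h
  linarith

theorem cast_mem_Icc_of_mem_oddFinset {n : ℕ} {ξ : ℚ} (hξ : ξ ∈ oddFinset n) :
    (ξ : ℝ) ∈ Icc (0 : ℝ) 1 :=
  ⟨by exact_mod_cast (mem_Icc_of_mem_oddFinset hξ).1,
    by exact_mod_cast (mem_Icc_of_mem_oddFinset hξ).2⟩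

theorem cast_pos_of_mem_oddFinset {n : ℕ} {ξ : ℚ} (hξ : ξ ∈ oddFinset n) (hne : ξ ≠ 0) :
    (0 : ℝ) < ξ :=
  (cast_mem_Icc_of_mem_oddFinset hξ).1.lt_of_ne' (by exact_mod_cast hne)

theorem cast_lt_one_of_mem_oddFinset {n : ℕ} {ξ : ℚ} (hξ : ξ ∈ oddFinset n) (hne : ξ ≠ 1) :
    (ξ : ℝ) < 1 :=
  (cast_mem_Icc_of_mem_oddFinset hξ).2.lt_of_ne (by exact_mod_cast hne)

theorem oddCount_leftMap (n : ℕ) {x : ℝ} (hx : x ∈ Icc (0 : ℝ) 1) :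
    oddCount (n + 3) (leftMap x) = oddCount (n + 2) 1 - oddCount (n + 2) x := by
  have hy := (leftMap_mem_Icc hx).2
  have hleft : ∑ ξ ∈ oddFinset (n + 2), jump (leftMap x) (leftMap (ξ : ℝ)) =
      2 * (oddFinset (n + 2)).card - ∑ ξ ∈ oddFinset (n + 2), jump x (ξ : ℝ) := by
    rw [Finset.sum_congr rfl fun ξ hξ => jump_map_of_strictAntiOn strictAntiOn_leftMap hx.2
      (cast_mem_Icc_of_mem_oddFinset hξ).2, Finset.sum_sub_distrib, Finset.sum_const,
      nsmul_eq_mul, mul_comm]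
  have hmid : ∑ ξ ∈ oddFinset n, jump (leftMap x) (midMap (ξ : ℝ)) =
      jump (leftMap x) (1 / 2) := by
    rw [Finset.sum_eq_single_of_mem 0 (zero_mem_oddFinset n), Rat.cast_zero, midMap_zero]
    exact fun ξ hξ hne =>
      jump_of_lt (hy.trans_lt (half_lt_midMap (cast_pos_of_mem_oddFinset hξ hne)))
  have hright : ∑ ξ ∈ oddFinset (n + 1), jump (leftMap x) (rightMap (ξ : ℝ)) = 0 :=
    Finset.sum_eq_zero fun ξ hξ => jump_of_lt ((hy.trans_lt (by norm_num)).trans_le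
      (rightMap_mem_Icc (cast_mem_Icc_of_mem_oddFinset hξ)).1)
  have htwo_thirds : jump (leftMap x) (2 / 3) = 0 := jump_of_lt (hy.trans_lt (by norm_num))
  rw [oddCount_one, oddCount, oddCount, sum_oddFinset_add_three, hleft, hmid, hright,
    htwo_thirds]
  ring

theorem oddCount_midMap (n : ℕ) {x : ℝ} (hx : x ∈ Icc (0 : ℝ) 1) :
    oddCount (n + 3) (midMap x) = oddCount (n + 2) 1 + oddCount n x := by
  obtain ⟨hy, hy'⟩ := midMap_mem_Icc hx
  have hleft : ∑ ξ ∈ oddFinset (n + 2), jump (midMap x) (leftMap (ξ : ℝ)) =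
      2 * ((oddFinset (n + 2)).card - 1) + jump (midMap x) (1 / 2) := by
    rw [sum_eq_add_of_forall_ne_eq (c := 2) (zero_mem_oddFinset _), Rat.cast_zero, leftMap_zero]
    exact fun ξ hξ hne => jump_of_gt ((leftMap_lt_half (cast_pos_of_mem_oddFinset hξ hne)
      (cast_mem_Icc_of_mem_oddFinset hξ).2).trans_le hy)
  have hmid : ∑ ξ ∈ oddFinset n, jump (midMap x) (midMap (ξ : ℝ)) =
      ∑ ξ ∈ oddFinset n, jump x (ξ : ℝ) :=
    Finset.sum_congr rfl fun ξ hξ => jump_map_of_strictMonoOn strictMonoOn_midMap hx.1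
      (cast_mem_Icc_of_mem_oddFinset hξ).1
  have hright : ∑ ξ ∈ oddFinset (n + 1), jump (midMap x) (rightMap (ξ : ℝ)) =
      jump (midMap x) (2 / 3) := by
    rw [Finset.sum_eq_single_of_mem 0 (zero_mem_oddFinset _), Rat.cast_zero, rightMap_zero]
    exact fun ξ hξ hne => jump_of_lt (hy'.trans_lt (two_thirds_lt_rightMap
      (cast_pos_of_mem_oddFinset hξ hne) (cast_mem_Icc_of_mem_oddFinset hξ).2))
  rw [oddCount_one, oddCount, oddCount, sum_oddFinset_add_three, hleft, hmid, hright]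
  ring

theorem oddCount_rightMap (n : ℕ) {x : ℝ} (hx : x ∈ Icc (0 : ℝ) 1) :
    oddCount (n + 3) (rightMap x) =
      oddCount (n + 2) 1 + oddCount n 1 + oddCount (n + 1) x := by
  have hy := (rightMap_mem_Icc hx).1
  have hleft : ∑ ξ ∈ oddFinset (n + 2), jump (rightMap x) (leftMap (ξ : ℝ)) =
      2 * (oddFinset (n + 2)).card := by
    rw [Finset.sum_congr rfl fun ξ hξ => jump_of_gt
      ((leftMap_mem_Icc (cast_mem_Icc_of_mem_oddFinset hξ)).2.trans_lt
        (lt_of_lt_of_le (by norm_num) hy)), Finset.sum_const, nsmul_eq_mul, mul_comm]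
  have hmid : ∑ ξ ∈ oddFinset n, jump (rightMap x) (midMap (ξ : ℝ)) =
      2 * ((oddFinset n).card - 1) + jump (rightMap x) (2 / 3) := by
    rw [sum_eq_add_of_forall_ne_eq (c := 2) (one_mem_oddFinset n), Rat.cast_one, midMap_one]
    exact fun ξ hξ hne => jump_of_gt ((midMap_lt_two_thirds
      (cast_mem_Icc_of_mem_oddFinset hξ).1 (cast_lt_one_of_mem_oddFinset hξ hne)).trans_le hy)
  have hright : ∑ ξ ∈ oddFinset (n + 1), jump (rightMap x) (rightMap (ξ : ℝ)) =
      ∑ ξ ∈ oddFinset (n + 1), jump x (ξ : ℝ) :=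
    Finset.sum_congr rfl fun ξ hξ => jump_map_of_strictMonoOn strictMonoOn_rightMap hx.2
      (cast_mem_Icc_of_mem_oddFinset hξ).2
  have hhalf : jump (rightMap x) (1 / 2) = 2 := jump_of_gt (lt_of_lt_of_le (by norm_num) hy)
  rw [oddCount_one, oddCount_one, oddCount, oddCount, sum_oddFinset_add_three, hleft, hmid,
    hright, hhalf]
  ring

theorem ncard_oddM (n : ℕ) : ((oddM n).ncard : ℝ) = (oddCount n 1 + 2) / 2 := by
  rw [oddCount_one, oddFinset, ncard_eq_toFinset_card _ (finite_oddM n)]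
  ring

theorem ncard_le_mem_Icc (n : ℕ) (x : ℝ) :
    ({ξ : ℚ | ξ ∈ oddM n ∧ (ξ : ℝ) ≤ x}.ncard : ℝ) ∈
      Icc ((oddCount n x + 1) / 2) ((oddCount n x + 2) / 2) := by
  have hle : ({ξ : ℚ | ξ ∈ oddM n ∧ (ξ : ℝ) ≤ x}.ncard : ℝ) =
      ((oddFinset n).filter fun ξ : ℚ => (ξ : ℝ) ≤ x).card := by
    rw [← ncard_coe_finset, Finset.coe_filter]
    simp only [mem_oddFinset]
  have hlt : ((oddFinset n).filter fun ξ : ℚ => (ξ : ℝ) < x).card ≤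
      ((oddFinset n).filter fun ξ : ℚ => (ξ : ℝ) ≤ x).card :=
    Finset.card_le_card (Finset.monotone_filter_right _ fun _ _ h => le_of_lt h)
  have hle_succ : ((oddFinset n).filter fun ξ : ℚ => (ξ : ℝ) ≤ x).card ≤
      ((oddFinset n).filter fun ξ : ℚ => (ξ : ℝ) < x).card + 1 := by
    have hor : ((oddFinset n).filter fun ξ : ℚ => (ξ : ℝ) ≤ x) =
        ((oddFinset n).filter fun ξ : ℚ => (ξ : ℝ) < x) ∪
          (oddFinset n).filter fun ξ : ℚ => (ξ : ℝ) = x := by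
      simp only [le_iff_lt_or_eq, Finset.filter_or]
    rw [hor]
    refine (Finset.card_union_le _ _).trans (Nat.add_le_add_left ?_ _)
    refine Finset.card_le_one.2 fun ξ hξ η hη => ?_
    exact Rat.cast_injective ((Finset.mem_filter.1 hξ).2.trans (Finset.mem_filter.1 hη).2.symm)
  have hcount : oddCount n x = ((oddFinset n).filter fun ξ : ℚ => (ξ : ℝ) < x).card +
      ((oddFinset n).filter fun ξ : ℚ => (ξ : ℝ) ≤ x).card - 1 := by
    simp only [oddCount, jump, Finset.sum_add_distrib, Finset.sum_boole]
  rify at hlt hle_succ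
  rw [hle, hcount]
  constructor <;> linarith

/-! ### Convergence -/

/-- `z` is the positive root of `z + z ^ 2 + z ^ 3 = 1`, the inverse of the tribonacci constant:
it normalizes the growth of `M_n`. -/
structure IsTribonacciRoot (z : ℝ) : Prop where
  pos : 0 < z
  eq_one : z + z ^ 2 + z ^ 3 = 1

theorem exists_isTribonacciRoot : ∃ z, IsTribonacciRoot z := by
  have hc : ContinuousOn (fun z : ℝ => z + z ^ 2 + z ^ 3) (Icc 0 1) := by fun_prop
  obtain ⟨z, hz, h⟩ := intermediate_value_Ioo zero_le_one hc
    (show (1 : ℝ) ∈ Ioo _ _ by constructor <;> norm_num)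
  exact ⟨z, hz.1, h⟩

namespace IsTribonacciRoot

variable {z : ℝ} (hz : IsTribonacciRoot z)
include hz

theorem lower : 0.5436 < z := by
  by_contra! h
  have h₂ := pow_le_pow_left₀ hz.pos.le h 2
  have h₃ := pow_le_pow_left₀ hz.pos.le h 3
  norm_num at h h₂ h₃
  linarith [hz.eq_one]

theorem upper : z < 0.5437 := by
  by_contra! h
  have h₂ := pow_le_pow_left₀ (by norm_num : (0 : ℝ) ≤ 0.5437) h 2
  have h₃ := pow_le_pow_left₀ (by norm_num : (0 : ℝ) ≤ 0.5437) h 3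
  norm_num at h h₂ h₃
  linarith [hz.eq_one]

theorem lt_one : z < 1 := hz.upper.trans (by norm_num)

theorem sq_lower : 0.2955 < z ^ 2 := by
  nlinarith [hz.lower]

theorem sq_upper : z ^ 2 < 0.2957 := by
  nlinarith [hz.lower, hz.upper]

theorem cube_lower : 0.1606 < z ^ 3 := by
  linarith [hz.eq_one, hz.upper, hz.sq_upper]

theorem cube_upper : z ^ 3 < 0.1609 := by
  linarith [hz.eq_one, hz.lower, hz.sq_lower]

/-- The differences `d n = u (n + 1) - u n` satisfy
`d (n + 2) = -(z ^ 2 + z ^ 3) * d (n + 1) - z ^ 3 * d n`, where the coefficients are small. -/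
theorem exists_abs_sub_le_of_recurrence {u : ℕ → ℝ}
    (hu : ∀ n, u (n + 3) = z * u (n + 2) + z ^ 2 * u (n + 1) + z ^ 3 * u n) :
    ∃ C, ∀ n, |u (n + 1) - u n| ≤ C * 0.8 ^ n := by
  have hz₃ : 0 < z ^ 3 := pow_pos hz.pos 3
  set C := max |u 1 - u 0| (|u 2 - u 1| / 0.8)
  refine ⟨C, fun n => ?_⟩
  induction n using Nat.twoStepInduction with
  | zero =>
    rw [pow_zero, mul_one]
    exact le_max_left _ _
  | one =>
    rw [pow_one, ← div_le_iff₀ (by norm_num)]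
    exact le_max_right _ _
  | more n ih₀ ih₁ =>
    have hd : u (n + 3) - u (n + 2) =
        -((z ^ 2 + z ^ 3) * (u (n + 2) - u (n + 1)) + z ^ 3 * (u (n + 1) - u n)) := by
      rw [hu]
      linear_combination u (n + 2) * hz.eq_one
    have hC : 0 ≤ C * 0.8 ^ n := (abs_nonneg _).trans ih₀
    calc |u (n + 3) - u (n + 2)|
        ≤ (z ^ 2 + z ^ 3) * |u (n + 2) - u (n + 1)| + z ^ 3 * |u (n + 1) - u n| := by
          rw [hd, abs_neg]
          refine (abs_add_le _ _).trans_eq ?_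
          rw [abs_mul, abs_mul, abs_of_pos hz₃, abs_of_pos (by positivity)]
      _ ≤ (0.3 + 0.17) * (C * 0.8 ^ (n + 1)) + 0.17 * (C * 0.8 ^ n) := by
          gcongr <;> linarith [hz.sq_upper, hz.cube_upper]
      _ ≤ C * 0.8 ^ (n + 2) := by
          rw [pow_succ, pow_add]
          linarith

/-- `u (n + 2) + (z ^ 2 + z ^ 3) * u (n + 1) + z ^ 3 * u n` does not depend on `n`. -/
theorem pos_of_tendsto_of_recurrence {u : ℕ → ℝ} {c : ℝ}
    (hu : ∀ n, u (n + 3) = z * u (n + 2) + z ^ 2 * u (n + 1) + z ^ 3 * u n)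
    (hpos : ∀ n, 0 < u n) (hc : Tendsto u atTop (𝓝 c)) : 0 < c := by
  have hz₀ := hz.pos
  set v : ℕ → ℝ := fun n => u (n + 2) + (z ^ 2 + z ^ 3) * u (n + 1) + z ^ 3 * u n with hv
  have hconst (n : ℕ) : v n = v 0 := by
    induction n with
    | zero => rfl
    | succ n ih =>
      rw [← ih]
      simp only [hv, hu]
      linear_combination u (n + 2) * hz.eq_one
  have hlim : Tendsto v atTop (𝓝 (c + (z ^ 2 + z ^ 3) * c + z ^ 3 * c)) :=
    ((hc.comp (tendsto_add_atTop_nat 2)).add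
      ((hc.comp (tendsto_add_atTop_nat 1)).const_mul _)).add (hc.const_mul _)
  have hv₀ : (1 + z ^ 2 + 2 * z ^ 3) * c = v 0 := by
    rw [← tendsto_nhds_unique hlim (tendsto_const_nhds.congr fun n => (hconst n).symm)]
    ring
  have hv_pos : 0 < v 0 := by
    have := hpos 0
    have := hpos 1
    have := hpos 2
    positivity
  rw [← hv₀] at hv_pos
  exact pos_of_mul_pos_right hv_pos (by positivity)

end IsTribonacciRoot

/-- The recursions along the branches that the counting functions of the sets `M_n`, scaled by
`z ^ n`, satisfy. They are linear, hence inherited by increments. -/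
structure IsBranchRecursive (z : ℝ) (u : ℕ → ℝ → ℝ) : Prop where
  left : ∀ n, ∀ x ∈ Icc (0 : ℝ) 1, u (n + 3) (leftMap x) = z * u (n + 2) 1 - z * u (n + 2) x
  mid : ∀ n, ∀ x ∈ Icc (0 : ℝ) 1, u (n + 3) (midMap x) = z * u (n + 2) 1 + z ^ 3 * u n x
  right : ∀ n, ∀ x ∈ Icc (0 : ℝ) 1,
    u (n + 3) (rightMap x) = z * u (n + 2) 1 + z ^ 3 * u n 1 + z ^ 2 * u (n + 1) x

namespace IsBranchRecursive

variable {z : ℝ} {u : ℕ → ℝ → ℝ} (hu : IsBranchRecursive z u)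
include hu

theorem one_add_three (n : ℕ) :
    u (n + 3) 1 = z * u (n + 2) 1 + z ^ 2 * u (n + 1) 1 + z ^ 3 * u n 1 := by
  have h := hu.right n 1 (right_mem_Icc.2 zero_le_one)
  rw [rightMap_one] at h
  rw [h]
  ring

theorem increment : IsBranchRecursive z fun n x => u (n + 1) x - u n x where
  left n x hx := by rw [hu.left (n + 1) x hx, hu.left n x hx]; ring
  mid n x hx := by rw [hu.mid (n + 1) x hx, hu.mid n x hx]; ring
  right n x hx := by rw [hu.right (n + 1) x hx, hu.right n x hx]; ring

theorem of_tendsto {G : ℝ → ℝ}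
    (hG : ∀ x ∈ Icc (0 : ℝ) 1, Tendsto (fun n => u n x) atTop (𝓝 (G x))) :
    IsBranchRecursive z fun _ => G := by
  have hshift (k : ℕ) {x : ℝ} (hx : x ∈ Icc (0 : ℝ) 1) :
      Tendsto (fun n => u (n + k) x) atTop (𝓝 (G x)) :=
    (hG x hx).comp (tendsto_add_atTop_nat k)
  have hone (k : ℕ) := hshift k (right_mem_Icc.2 zero_le_one)
  constructor <;> intro _ x hx
  · refine tendsto_nhds_unique ((hshift 3 (mapsTo_leftMap hx)).congr fun n => hu.left n x hx) ?_
    exact ((hone 2).const_mul z).sub ((hshift 2 hx).const_mul z)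
  · refine tendsto_nhds_unique ((hshift 3 (mapsTo_midMap hx)).congr fun n => hu.mid n x hx) ?_
    exact ((hone 2).const_mul z).add ((hshift 0 hx).const_mul _)
  · refine tendsto_nhds_unique ((hshift 3 (mapsTo_rightMap hx)).congr fun n => hu.right n x hx) ?_
    exact (((hone 2).const_mul z).add ((hone 0).const_mul _)).add ((hshift 1 hx).const_mul _)

variable (hz : IsTribonacciRoot z)
include hz

theorem abs_add_three_le {A C x : ℝ} {n : ℕ} (hCA : 3 * C ≤ A)
    (hone : ∀ m, |u m 1| ≤ C * 0.8 ^ m)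
    (ih : ∀ m < n + 3, ∀ y ∈ Icc (0 : ℝ) 1, |u m y| ≤ A * 0.8 ^ m) (hx : x ∈ Icc (0 : ℝ) 1) :
    |u (n + 3) x| ≤ A * 0.8 ^ (n + 3) := by
  have hmul {a b B c : ℝ} (ha : 0 < a) (hac : a ≤ c) (hb : |b| ≤ B) : |a * b| ≤ c * B := by
    rw [abs_mul, abs_of_pos ha]
    exact mul_le_mul hac hb (abs_nonneg b) (ha.le.trans hac)
  have hz₁ {b B : ℝ} : |b| ≤ B → |z * b| ≤ 0.55 * B :=
    hmul hz.pos (hz.upper.le.trans (by norm_num))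
  have hz₂ {b B : ℝ} : |b| ≤ B → |z ^ 2 * b| ≤ 0.3 * B :=
    hmul (pow_pos hz.pos 2) (hz.sq_upper.le.trans (by norm_num))
  have hz₃ {b B : ℝ} : |b| ≤ B → |z ^ 3 * b| ≤ 0.17 * B :=
    hmul (pow_pos hz.pos 3) (hz.cube_upper.le.trans (by norm_num))
  have hCA' : 3 * (C * 0.8 ^ n) ≤ A * 0.8 ^ n := by
    rw [← mul_assoc]
    gcongr
  have hA : 0 ≤ A * 0.8 ^ n :=
    (abs_nonneg _).trans (ih n (by omega) 0 (left_mem_Icc.2 zero_le_one))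
  obtain ⟨y, hy, rfl | rfl | rfl⟩ := exists_eq_branch hx
  · rw [hu.left n y hy]
    refine (abs_sub _ _).trans ((add_le_add (hz₁ (hone _)) (hz₁ (ih _ (by omega) y hy))).trans ?_)
    rw [pow_add, pow_add]
    linarith
  · rw [hu.mid n y hy]
    refine (abs_add_le _ _).trans
      ((add_le_add (hz₁ (hone _)) (hz₃ (ih _ (by omega) y hy))).trans ?_)
    rw [pow_add, pow_add]
    linarith
  · rw [hu.right n y hy]
    refine (abs_add_three _ _ _).trans ((add_le_add (add_le_add (hz₁ (hone _)) (hz₃ (hone _)))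
      (hz₂ (ih _ (by omega) y hy))).trans ?_)
    rw [pow_add, pow_add, pow_add]
    linarith

theorem exists_abs_le {B C : ℝ} (hone : ∀ n, |u n 1| ≤ C * 0.8 ^ n)
    (hB : ∀ n < 3, ∀ x ∈ Icc (0 : ℝ) 1, |u n x| ≤ B) :
    ∃ A, ∀ n, ∀ x ∈ Icc (0 : ℝ) 1, |u n x| ≤ A * 0.8 ^ n := by
  obtain ⟨A, hCA, hBA⟩ : ∃ A, 3 * C ≤ A ∧ B / 0.8 ^ 2 ≤ A := ⟨_, le_max_left _ _, le_max_right _ _⟩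
  have hB₀ : 0 ≤ B := (abs_nonneg _).trans (hB 0 (by omega) 0 (left_mem_Icc.2 zero_le_one))
  have hA : 0 ≤ A := (by positivity : 0 ≤ B / 0.8 ^ 2).trans hBA
  refine ⟨A, fun n => ?_⟩
  induction n using Nat.strong_induction_on with
  | _ n ih =>
    intro x hx
    obtain hn | hn := lt_or_ge n 3
    · calc |u n x| ≤ B := hB n hn x hx
        _ ≤ A * 0.8 ^ 2 := (div_le_iff₀ (by norm_num)).1 hBA
        _ ≤ A * 0.8 ^ n := mul_le_mul_of_nonneg_left
          (pow_le_pow_of_le_one (by norm_num) (by norm_num) (by omega)) hA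
    · obtain ⟨n, rfl⟩ := Nat.exists_eq_add_of_le' hn
      exact hu.abs_add_three_le hz hCA hone ih hx

theorem exists_tendsto (hmem : ∀ n, ∀ x ∈ Icc (0 : ℝ) 1, u n x ∈ Icc 0 (u n 1)) :
    ∃ G : ℝ → ℝ, ∀ x ∈ Icc (0 : ℝ) 1, Tendsto (fun n => u n x) atTop (𝓝 (G x)) := by
  obtain ⟨C, hC⟩ := hz.exists_abs_sub_le_of_recurrence (u := fun n => u n 1) hu.one_add_three
  have hnonneg (n : ℕ) : 0 ≤ u n 1 := (hmem n 1 (right_mem_Icc.2 zero_le_one)).1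
  have hle {i : ℕ} (hi : i < 4) {x : ℝ} (hx : x ∈ Icc (0 : ℝ) 1) :
      u i x ∈ Icc 0 (∑ i ∈ Finset.range 4, u i 1) :=
    Icc_subset_Icc_right (Finset.single_le_sum (f := fun i => u i 1) (fun i _ => hnonneg i)
      (Finset.mem_range.2 hi)) (hmem i x hx)
  obtain ⟨A, hA⟩ := hu.increment.exists_abs_le hz hC fun n hn x hx =>
    have h₁ := hle (i := n + 1) (by omega) hx
    have h₀ := hle (i := n) (by omega) hx
    abs_sub_le_of_nonneg_of_le h₁.1 h₁.2 h₀.1 h₀.2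
  have hlim (x : ℝ) (hx : x ∈ Icc (0 : ℝ) 1) : ∃ c, Tendsto (fun n => u n x) atTop (𝓝 c) :=
    cauchySeq_tendsto_of_complete (cauchySeq_of_le_geometric 0.8 A (by norm_num) fun n => by
      rw [dist_comm, Real.dist_eq]
      exact hA n x hx)
  choose! G hG using hlim
  exact ⟨G, hG⟩

end IsBranchRecursive

/-- The symmetric count, scaled so as to converge when `z` is the tribonacci root. -/
noncomputable def scaledCount (z : ℝ) (n : ℕ) (x : ℝ) : ℝ := z ^ n * oddCount n x

theorem isBranchRecursive_scaledCount (z : ℝ) : IsBranchRecursive z (scaledCount z) where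
  left n x hx := by simp only [scaledCount, oddCount_leftMap n hx]; ring
  mid n x hx := by simp only [scaledCount, oddCount_midMap n hx]; ring
  right n x hx := by simp only [scaledCount, oddCount_rightMap n hx]; ring

theorem scaledCount_zero (z : ℝ) (n : ℕ) : scaledCount z n 0 = 0 := by
  rw [scaledCount, oddCount_zero, mul_zero]

theorem monotone_scaledCount {z : ℝ} (hz : 0 ≤ z) (n : ℕ) : Monotone (scaledCount z n) :=
  (monotone_oddCount n).const_mul (pow_nonneg hz n)

theorem oddDistrib_mem_Icc {z : ℝ} (hz : 0 < z) (n : ℕ) (x : ℝ) :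
    oddDistrib n x ∈ Icc ((scaledCount z n x + z ^ n) / (scaledCount z n 1 + 2 * z ^ n))
      ((scaledCount z n x + 2 * z ^ n) / (scaledCount z n 1 + 2 * z ^ n)) := by
  have hzn : 0 < z ^ n := pow_pos hz n
  have hcard : 0 < oddCount n 1 + 2 := add_pos (oddCount_one_pos n) two_pos
  have hden : scaledCount z n 1 + 2 * z ^ n = z ^ n * (oddCount n 1 + 2) := by
    rw [scaledCount]
    ring
  have hdistrib : oddDistrib n x = z ^ n * (2 * {ξ : ℚ | ξ ∈ oddM n ∧ (ξ : ℝ) ≤ x}.ncard) /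
      (scaledCount z n 1 + 2 * z ^ n) := by
    rw [oddDistrib, ncard_oddM, hden]
    field_simp
  obtain ⟨hlower, hupper⟩ := ncard_le_mem_Icc n x
  rw [hdistrib, scaledCount]
  have hden_nonneg : 0 ≤ scaledCount z n 1 + 2 * z ^ n := hden ▸ by positivity
  constructor
  · gcongr
    nlinarith
  · gcongr
    nlinarith

/-- `F` is a distribution function on `[0, 1]` for which the three branches carry the masses `p`,
`q` and `r`, and transport `F` affinely. -/
structure IsSelfSimilar (p q r : ℝ) (F : ℝ → ℝ) : Prop where
  monotoneOn : MonotoneOn F (Icc 0 1)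
  one : F 1 = 1
  left : ∀ x ∈ Icc (0 : ℝ) 1, F (leftMap x) = p * (1 - F x)
  mid : ∀ x ∈ Icc (0 : ℝ) 1, F (midMap x) = p + q * F x
  right : ∀ x ∈ Icc (0 : ℝ) 1, F (rightMap x) = p + q + r * F x

theorem exists_isSelfSimilar_tendsto_oddDistrib {z : ℝ} (hz : IsTribonacciRoot z) :
    ∃ F, IsSelfSimilar z (z ^ 3) (z ^ 2) F ∧
      ∀ x ∈ Icc (0 : ℝ) 1, Tendsto (fun n => oddDistrib n x) atTop (𝓝 (F x)) := by
  have hrec := isBranchRecursive_scaledCount z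
  obtain ⟨G, hG⟩ := hrec.exists_tendsto hz fun n x hx =>
    ⟨scaledCount_zero z n ▸ monotone_scaledCount hz.pos.le n hx.1,
      monotone_scaledCount hz.pos.le n hx.2⟩
  have hlim := hrec.of_tendsto hG
  have hG₁ := hG 1 (right_mem_Icc.2 zero_le_one)
  have hG₁_pos : 0 < G 1 := hz.pos_of_tendsto_of_recurrence hrec.one_add_three
    (fun n => mul_pos (pow_pos hz.pos n) (oddCount_one_pos n)) hG₁
  refine ⟨fun x => G x / G 1, ⟨?_, div_self hG₁_pos.ne', ?_, ?_, ?_⟩, fun x hx => ?_⟩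
  · exact fun x hx y hy hxy => div_le_div_of_nonneg_right (le_of_tendsto_of_tendsto' (hG x hx)
      (hG y hy) fun n => monotone_scaledCount hz.pos.le n hxy) hG₁_pos.le
  · intro x hx
    rw [hlim.left 0 x hx]
    field_simp
  · intro x hx
    rw [hlim.mid 0 x hx]
    field_simp
  · intro x hx
    rw [hlim.right 0 x hx]
    field_simp
  · have hpow := tendsto_pow_atTop_nhds_zero_of_lt_one hz.pos.le hz.lt_one
    have hden := hG₁.add (hpow.const_mul 2)
    have hlower := ((hG x hx).add hpow).div hden (by simpa using hG₁_pos.ne')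
    have hupper := ((hG x hx).add (hpow.const_mul 2)).div hden (by simpa using hG₁_pos.ne')
    simp only [mul_zero, add_zero] at hlower hupper
    exact tendsto_of_tendsto_of_tendsto_of_le_of_le hlower hupper
      (fun n => (oddDistrib_mem_Icc hz.pos n x).1) fun n => (oddDistrib_mem_Icc hz.pos n x).2

namespace IsSelfSimilar

variable {p q r : ℝ} {F : ℝ → ℝ} (hF : IsSelfSimilar p q r F)
include hF

theorem zero : F 0 = 0 := by
  have h := hF.left 1 (right_mem_Icc.2 zero_le_one)
  rwa [leftMap_one, hF.one, sub_self, mul_zero] at h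

theorem add_add_eq_one : p + q + r = 1 := by
  have h := hF.right 1 (right_mem_Icc.2 zero_le_one)
  rw [rightMap_one, hF.one] at h
  linarith

theorem mapsTo_Icc : MapsTo F (Icc 0 1) (Icc 0 1) := by
  simpa only [hF.zero, hF.one] using hF.monotoneOn.mapsTo_Icc

variable (hp : 0 < p) (hq : 0 < q) (hr : 0 < r)
include hp hq hr

theorem exists_eq_affine {t : ℝ} (ht : t ∈ Icc (0 : ℝ) 1) :
    ∃ t' ∈ Icc (0 : ℝ) 1, t = p * (1 - t') ∨ t = p + q * t' ∨ t = p + q + r * t' := by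
  have hsum := hF.add_add_eq_one
  rcases le_total t p with h | h
  · refine ⟨1 - t / p, ⟨?_, ?_⟩, .inl ?_⟩
    · rw [sub_nonneg, div_le_one hp]
      exact h
    · rw [sub_le_self_iff]
      exact div_nonneg ht.1 hp.le
    · field_simp
      ring
  rcases le_total t (p + q) with h' | h'
  · refine ⟨(t - p) / q, ⟨div_nonneg (by linarith) hq.le, ?_⟩, .inr (.inl ?_)⟩
    · rw [div_le_one hq]
      linarith
    · field_simp
      ring
  · refine ⟨(t - p - q) / r, ⟨div_nonneg (by linarith) hr.le, ?_⟩, .inr (.inr ?_)⟩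
    · rw [div_le_one hr]
      linarith [ht.2]
    · field_simp
      ring

theorem exists_abs_sub_le_pow {m : ℝ} (hpm : p ≤ m) (hqm : q ≤ m) (hrm : r ≤ m) (k : ℕ) :
    ∀ t ∈ Icc (0 : ℝ) 1, ∃ x ∈ Icc (0 : ℝ) 1, |F x - t| ≤ m ^ k := by
  induction k with
  | zero =>
    intro t ht
    refine ⟨0, left_mem_Icc.2 zero_le_one, ?_⟩
    rw [hF.zero, zero_sub, abs_neg, abs_of_nonneg ht.1, pow_zero]
    exact ht.2
  | succ k ih =>
    intro t ht
    obtain ⟨t', ht', h⟩ := hF.exists_eq_affine hp hq hr ht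
    obtain ⟨x, hx, hxt⟩ := ih t' ht'
    have hmul {w : ℝ} (hw : 0 < w) (hwm : w ≤ m) : |w * (F x - t')| ≤ m ^ (k + 1) := by
      rw [abs_mul, abs_of_pos hw, pow_succ']
      exact mul_le_mul hwm hxt (abs_nonneg _) (hw.le.trans hwm)
    rcases h with rfl | rfl | rfl
    · refine ⟨leftMap x, mapsTo_leftMap hx, ?_⟩
      rw [hF.left x hx, ← abs_neg]
      convert hmul hp hpm using 2
      ring
    · refine ⟨midMap x, mapsTo_midMap hx, ?_⟩
      rw [hF.mid x hx]
      convert hmul hq hqm using 2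
      ring
    · refine ⟨rightMap x, mapsTo_rightMap hx, ?_⟩
      rw [hF.right x hx]
      convert hmul hr hrm using 2
      ring

theorem continuousOn : ContinuousOn F (Icc 0 1) := by
  have hsum := hF.add_add_eq_one
  set m := max p (max q r)
  have hm₁ : m < 1 := max_lt (by linarith) (max_lt (by linarith) (by linarith))
  let G : Icc (0 : ℝ) 1 → Icc (0 : ℝ) 1 := hF.mapsTo_Icc.restrict F _ _
  have hG : Monotone G := fun x y h => hF.monotoneOn x.2 y.2 h
  have hdense : DenseRange G := fun t => Metric.mem_closure_iff.2 fun ε hε => by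
    obtain ⟨k, hk⟩ := exists_pow_lt_of_lt_one hε hm₁
    obtain ⟨x, hx, h⟩ := hF.exists_abs_sub_le_pow hp hq hr (le_max_left p (max q r))
      ((le_max_left q r).trans (le_max_right p _)) ((le_max_right q r).trans (le_max_right p _))
      k t t.2
    refine ⟨G ⟨x, hx⟩, mem_range_self _, ?_⟩
    rw [dist_comm]
    exact h.trans_lt hk
  rw [continuousOn_iff_continuous_domRestrict]
  exact continuous_subtype_val.comp (hG.continuous_of_denseRange hdense)

end IsSelfSimilar

/-! ### Mean slopes over cylinders -/

theorem tendsto_slope_of_hasDerivWithinAt {ι : Type*} {l : Filter ι} {f : ℝ → ℝ} {d x : ℝ}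
    {s : Set ℝ} {u v : ι → ℝ} (hf : HasDerivWithinAt f d s x) (hu : Tendsto u l (𝓝[s] x))
    (hv : Tendsto v l (𝓝[s] x)) (hne : ∀ i, u i ≠ v i)
    (hux : (fun i => u i - x) =O[l] fun i => v i - u i)
    (hvx : (fun i => v i - x) =O[l] fun i => v i - u i) :
    Tendsto (fun i => slope f (u i) (v i)) l (𝓝 d) := by
  have ho := hasDerivWithinAt_iff_isLittleO.1 hf
  have h := ((ho.comp_tendsto hv).trans_isBigO hvx).sub ((ho.comp_tendsto hu).trans_isBigO hux)
  rw [← tendsto_sub_nhds_zero_iff]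
  refine h.tendsto_div_nhds_zero.congr fun i => ?_
  have hi : v i - u i ≠ 0 := sub_ne_zero.2 (hne i).symm
  simp only [Function.comp_apply, smul_eq_mul, slope_def_field]
  field_simp
  ring

/-- A cylinder around `x`: a composition `φ` of branches with `φ y = x`, recorded through its
distortion `|φ w - φ w'| = |w - w'| / (D w * D w')`, where `D w = s * (1 - w) + t * w`, and the
mass `m` of its image, that is `|F (φ w) - F (φ w')| = m * |F w - F w'|`. Thus `s` and `t` are the
denominators of the two end points of the image. -/
structure BranchCylinder (F : ℝ → ℝ) (x : ℝ) where
  φ : ℝ → ℝ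
  s : ℝ
  t : ℝ
  m : ℝ
  y : ℝ
  one_le_s : 1 ≤ s
  one_le_t : 1 ≤ t
  m_pos : 0 < m
  y_mem : y ∈ Icc (0 : ℝ) 1
  φ_y : φ y = x
  mapsTo : MapsTo φ (Icc 0 1) (Icc 0 1)
  abs_sub : ∀ w ∈ Icc (0 : ℝ) 1, ∀ w' ∈ Icc (0 : ℝ) 1,
    |φ w - φ w'| = |w - w'| / ((s * (1 - w) + t * w) * (s * (1 - w') + t * w'))
  abs_sub_map : ∀ w ∈ Icc (0 : ℝ) 1, ∀ w' ∈ Icc (0 : ℝ) 1,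
    |F (φ w) - F (φ w')| = m * |F w - F w'|

theorem abs_leftMap_sub {a b : ℝ} (ha : a ∈ Icc (0 : ℝ) 1) (hb : b ∈ Icc (0 : ℝ) 1) :
    |leftMap a - leftMap b| = |a - b| / ((2 - a) * (2 - b)) := by
  have ha' : 0 < 2 - a := by linarith [ha.2]
  have hb' : 0 < 2 - b := by linarith [hb.2]
  rw [abs_sub_comm a, ← abs_of_pos (mul_pos ha' hb'), ← abs_div]
  congr 1
  rw [leftMap, leftMap]
  field_simp
  ring

theorem abs_midMap_sub {a b : ℝ} (ha : a ∈ Icc (0 : ℝ) 1) (hb : b ∈ Icc (0 : ℝ) 1) :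
    |midMap a - midMap b| = |a - b| / ((2 + a) * (2 + b)) := by
  have ha' : 0 < 2 + a := by linarith [ha.1]
  have hb' : 0 < 2 + b := by linarith [hb.1]
  rw [← abs_of_pos (mul_pos ha' hb'), ← abs_div]
  congr 1
  rw [midMap, midMap]
  field_simp
  ring

theorem abs_rightMap_sub {a b : ℝ} (ha : a ∈ Icc (0 : ℝ) 1) (hb : b ∈ Icc (0 : ℝ) 1) :
    |rightMap a - rightMap b| = |a - b| / ((3 - 2 * a) * (3 - 2 * b)) := by
  have ha' : 0 < 3 - 2 * a := by linarith [ha.2]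
  have hb' : 0 < 3 - 2 * b := by linarith [hb.2]
  rw [← abs_of_pos (mul_pos ha' hb'), ← abs_div]
  congr 1
  rw [rightMap, rightMap]
  field_simp
  ring

namespace BranchCylinder

variable {F : ℝ → ℝ} {x : ℝ}

/-- The cylinder of the empty composition. -/
def root (F : ℝ → ℝ) (hx : x ∈ Icc (0 : ℝ) 1) : BranchCylinder F x where
  φ := id
  s := 1
  t := 1
  m := 1
  y := x
  one_le_s := le_rfl
  one_le_t := le_rfl
  m_pos := one_pos
  y_mem := hx
  φ_y := rfl
  mapsTo := mapsTo_id _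
  abs_sub w _ w' _ := by simp
  abs_sub_map w _ w' _ := by simp

/-- The cylinder of `φ ∘ ψ`, for a map `ψ` with distortion `E` that multiplies masses by `k`. -/
def comp (c : BranchCylinder F x) (ψ E : ℝ → ℝ) {s t k y : ℝ} (hs : 1 ≤ s) (ht : 1 ≤ t) (hk : 0 < k)
    (hy : y ∈ Icc (0 : ℝ) 1) (hyψ : c.y = ψ y) (hψ : MapsTo ψ (Icc 0 1) (Icc 0 1))
    (hE : ∀ w ∈ Icc (0 : ℝ) 1, (c.s * (1 - ψ w) + c.t * ψ w) * E w = s * (1 - w) + t * w)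
    (hdist : ∀ w ∈ Icc (0 : ℝ) 1, ∀ w' ∈ Icc (0 : ℝ) 1, |ψ w - ψ w'| = |w - w'| / (E w * E w'))
    (hF : ∀ w ∈ Icc (0 : ℝ) 1, ∀ w' ∈ Icc (0 : ℝ) 1, |F (ψ w) - F (ψ w')| = k * |F w - F w'|) :
    BranchCylinder F x where
  φ := c.φ ∘ ψ
  s := s
  t := t
  m := k * c.m
  y := y
  one_le_s := hs
  one_le_t := ht
  m_pos := mul_pos hk c.m_pos
  y_mem := hy
  φ_y := by rw [Function.comp_apply, ← hyψ, c.φ_y]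
  mapsTo := c.mapsTo.comp hψ
  abs_sub w hw w' hw' := by
    rw [Function.comp_apply, Function.comp_apply, c.abs_sub _ (hψ hw) _ (hψ hw'),
      hdist w hw w' hw', ← hE w hw, ← hE w' hw', div_div]
    ring
  abs_sub_map w hw w' hw' := by
    rw [Function.comp_apply, Function.comp_apply, c.abs_sub_map _ (hψ hw) _ (hψ hw'),
      hF w hw w' hw']
    ring

/-- `c'` has the denominators and the mass of one of the three parts into which the branches
subdivide `c`. -/
def IsChild (p q r : ℝ) (c c' : BranchCylinder F x) : Prop :=
  (c'.s = c.s + c.t ∧ c'.t = c.s ∧ c'.m = p * c.m) ∨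
  (c'.s = c.s + c.t ∧ c'.t = c.s + 2 * c.t ∧ c'.m = q * c.m) ∨
  (c'.s = c.s + 2 * c.t ∧ c'.t = c.t ∧ c'.m = r * c.m)

theorem exists_isChild {p q r : ℝ} (hF : IsSelfSimilar p q r F) (hp : 0 < p) (hq : 0 < q)
    (hr : 0 < r) (c : BranchCylinder F x) : ∃ c', IsChild p q r c c' := by
  have hs := c.one_le_s
  have ht := c.one_le_t
  obtain ⟨y, hy, hl | hm | hr'⟩ := exists_eq_branch c.y_mem
  · refine ⟨c.comp leftMap (2 - ·) (by linarith) hs hp hy hl mapsTo_leftMap ?_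
      (fun w hw w' hw' => abs_leftMap_sub hw hw') ?_, .inl ⟨rfl, rfl, rfl⟩⟩
    · intro w hw
      have : 2 - w ≠ 0 := by linarith [hw.2]
      rw [leftMap]
      field_simp
      ring
    · intro w hw w' hw'
      rw [hF.left w hw, hF.left w' hw', ← mul_sub, sub_sub_sub_cancel_left, abs_mul,
        abs_of_pos hp, abs_sub_comm]
  · refine ⟨c.comp midMap (2 + ·) (by linarith) (by linarith) hq hy hm mapsTo_midMap ?_
      (fun w hw w' hw' => abs_midMap_sub hw hw') ?_, .inr (.inl ⟨rfl, rfl, rfl⟩)⟩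
    · intro w hw
      have : 2 + w ≠ 0 := by linarith [hw.1]
      rw [midMap]
      field_simp
      ring
    · intro w hw w' hw'
      rw [hF.mid w hw, hF.mid w' hw', add_sub_add_left_eq_sub, ← mul_sub, abs_mul, abs_of_pos hq]
  · refine ⟨c.comp rightMap (3 - 2 * ·) (by linarith) ht hr hy hr' mapsTo_rightMap ?_
      (fun w hw w' hw' => abs_rightMap_sub hw hw') ?_, .inr (.inr ⟨rfl, rfl, rfl⟩)⟩
    · intro w hw
      have : 3 - 2 * w ≠ 0 := by linarith [hw.2]
      rw [rightMap]
      field_simp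
      ring
    · intro w hw w' hw'
      rw [hF.right w hw, hF.right w' hw', add_sub_add_left_eq_sub, ← mul_sub, abs_mul,
        abs_of_pos hr]

theorem IsChild.mul_add_one_le {p q r : ℝ} {c c' : BranchCylinder F x} (h : IsChild p q r c c') :
    c.s * c.t + 1 ≤ c'.s * c'.t := by
  have hs := c.one_le_s
  have ht := c.one_le_t
  rcases h with ⟨hs', ht', -⟩ | ⟨hs', ht', -⟩ | ⟨hs', ht', -⟩ <;> rw [hs', ht'] <;> nlinarith

theorem exists_seq_isChild {p q r : ℝ} (hF : IsSelfSimilar p q r F) (hp : 0 < p) (hq : 0 < q)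
    (hr : 0 < r) (hx : x ∈ Icc (0 : ℝ) 1) : ∃ c : ℕ → BranchCylinder F x,
      (∀ n, IsChild p q r (c n) (c (n + 1))) ∧
      Tendsto (fun n => (c n).s * (c n).t) atTop atTop := by
  choose next hnext using exists_isChild (x := x) hF hp hq hr
  set c : ℕ → BranchCylinder F x := fun n => next^[n] (root F hx)
  have hc (n : ℕ) : IsChild p q r (c n) (c (n + 1)) := by
    simpa only [c, Function.iterate_succ_apply'] using hnext (c n)
  refine ⟨c, hc, tendsto_atTop_mono (fun n => ?_) tendsto_natCast_atTop_atTop⟩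
  induction n with
  | zero => simp [c, root]
  | succ n ih =>
    push_cast
    linarith [(hc n).mul_add_one_le]

/-- The mean slope of `F` over the cylinder. -/
def density (c : BranchCylinder F x) : ℝ := c.m * (c.s * c.t)

/-- The ratio of the end point denominators. It determines by which factor the mean slope changes
in each of the three parts of the cylinder, and the ratios of these parts. -/
noncomputable def ratio (c : BranchCylinder F x) : ℝ := c.s / c.t

theorem abs_φ_one_sub_φ_zero (c : BranchCylinder F x) : |c.φ 1 - c.φ 0| = (c.s * c.t)⁻¹ := by
  rw [c.abs_sub 1 (right_mem_Icc.2 zero_le_one) 0 (left_mem_Icc.2 zero_le_one)]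
  simp [mul_comm]

theorem abs_slope (c : BranchCylinder F x) (h₀ : F 0 = 0) (h₁ : F 1 = 1) :
    |slope F (c.φ 0) (c.φ 1)| = c.density := by
  rw [slope_def_field, abs_div, c.abs_φ_one_sub_φ_zero,
    c.abs_sub_map 1 (right_mem_Icc.2 zero_le_one) 0 (left_mem_Icc.2 zero_le_one), h₀, h₁,
    sub_zero, abs_one, mul_one, div_inv_eq_mul, density]

theorem denom_pos (c : BranchCylinder F x) : 0 < c.s * (1 - c.y) + c.t * c.y := by
  nlinarith [c.one_le_s, c.one_le_t, c.y_mem.1, c.y_mem.2]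

theorem abs_φ_zero_sub_le (c : BranchCylinder F x) : |c.φ 0 - x| ≤ |c.φ 1 - c.φ 0| := by
  have hs := c.one_le_s
  have ht := c.one_le_t
  have hD := c.denom_pos
  have h := c.abs_sub 0 (left_mem_Icc.2 zero_le_one) _ c.y_mem
  rw [c.φ_y, sub_zero, mul_zero, add_zero, mul_one, zero_sub, abs_neg,
    abs_of_nonneg c.y_mem.1] at h
  rw [h, c.abs_φ_one_sub_φ_zero, inv_eq_one_div, div_le_div_iff₀ (by positivity) (by positivity)]
  nlinarith [mul_nonneg (zero_le_one.trans hs) (sub_nonneg.2 c.y_mem.2)]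

theorem abs_φ_one_sub_le (c : BranchCylinder F x) : |c.φ 1 - x| ≤ |c.φ 1 - c.φ 0| := by
  have hs := c.one_le_s
  have ht := c.one_le_t
  have hD := c.denom_pos
  have h := c.abs_sub 1 (right_mem_Icc.2 zero_le_one) _ c.y_mem
  rw [c.φ_y, sub_self, mul_zero, zero_add, mul_one, abs_of_nonneg (sub_nonneg.2 c.y_mem.2)] at h
  rw [h, c.abs_φ_one_sub_φ_zero, inv_eq_one_div, div_le_div_iff₀ (by positivity) (by positivity)]
  nlinarith [mul_nonneg (zero_le_one.trans ht) c.y_mem.1]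

theorem tendsto_density {d : ℝ} {c : ℕ → BranchCylinder F x} (h₀ : F 0 = 0) (h₁ : F 1 = 1)
    (hc : Tendsto (fun n => (c n).s * (c n).t) atTop atTop)
    (hd : HasDerivWithinAt F d (Icc 0 1) x) : Tendsto (fun n => (c n).density) atTop (𝓝 |d|) := by
  have hlen : Tendsto (fun n => |(c n).φ 1 - (c n).φ 0|) atTop (𝓝 0) := by
    simp only [abs_φ_one_sub_φ_zero]
    exact tendsto_inv_atTop_zero.comp hc
  have hlim {w : ℝ} (hw : w ∈ Icc (0 : ℝ) 1)
      (hle : ∀ n, |(c n).φ w - x| ≤ |(c n).φ 1 - (c n).φ 0|) :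
      Tendsto (fun n => (c n).φ w) atTop (𝓝[Icc 0 1] x) := by
    refine tendsto_nhdsWithin_iff.2 ⟨?_, .of_forall fun n => (c n).mapsTo hw⟩
    exact tendsto_iff_dist_tendsto_zero.2 (squeeze_zero (fun _ => dist_nonneg) hle hlen)
  have hslope := tendsto_slope_of_hasDerivWithinAt hd
    (hlim (left_mem_Icc.2 zero_le_one) fun n => (c n).abs_φ_zero_sub_le)
    (hlim (right_mem_Icc.2 zero_le_one) fun n => (c n).abs_φ_one_sub_le) (fun n h => ?_)
    (Asymptotics.isBigO_of_le _ fun n => (c n).abs_φ_zero_sub_le)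
    (Asymptotics.isBigO_of_le _ fun n => (c n).abs_φ_one_sub_le)
  · simpa only [abs_slope _ h₀ h₁] using hslope.abs
  · have hpos : 0 < |(c n).φ 1 - (c n).φ 0| := by
      have := (c n).one_le_s
      have := (c n).one_le_t
      rw [abs_φ_one_sub_φ_zero]
      positivity
    rw [h, sub_self, abs_zero] at hpos
    exact hpos.false

theorem ratio_pos (c : BranchCylinder F x) : 0 < c.ratio := by
  have := c.one_le_s
  have := c.one_le_t
  rw [ratio]
  positivity

theorem IsChild.density_div_density {p q r : ℝ} {c c' : BranchCylinder F x}
    (h : IsChild p q r c c') :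
    (c'.ratio = 1 + 1 / c.ratio ∧ c'.density / c.density = p * (1 + c.ratio)) ∨
    (c'.ratio = (1 + c.ratio) / (2 + c.ratio) ∧
      c'.density / c.density = q * (1 + c.ratio) * (2 + c.ratio) / c.ratio) ∨
    (c'.ratio = c.ratio + 2 ∧ c'.density / c.density = r * (c.ratio + 2) / c.ratio) := by
  have hs : 0 < c.s := one_pos.trans_le c.one_le_s
  have ht : 0 < c.t := one_pos.trans_le c.one_le_t
  have hm := c.m_pos
  rcases h with ⟨hs', ht', hm'⟩ | ⟨hs', ht', hm'⟩ | ⟨hs', ht', hm'⟩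
  · refine .inl ⟨?_, ?_⟩ <;> simp only [ratio, density, hs', ht', hm'] <;> field_simp
    ring
  · refine .inr (.inl ⟨?_, ?_⟩) <;> simp only [ratio, density, hs', ht', hm'] <;> field_simp
    all_goals ring
  · refine .inr (.inr ⟨?_, ?_⟩) <;> simp only [ratio, density, hs', ht', hm'] <;> field_simp

end BranchCylinder

/-- The ratios of a cylinder for which the mean slope can stay almost unchanged in one of the
parts. The two intervals contain the solutions `ρ` of `z * (1 + ρ) = 1`,
`z ^ 3 * (1 + ρ) * (2 + ρ) / ρ = 1` and `z ^ 2 * (ρ + 2) / ρ = 1` for the tribonacci root `z`, with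
a margin for quotients close to `1`. -/
def IsBalanced (ρ : ℝ) : Prop := ρ ∈ Icc 0.82 0.88 ∪ Icc 2.3 2.5

namespace IsTribonacciRoot

variable {z ρ : ℝ} (hz : IsTribonacciRoot z)
include hz

theorem isBalanced_of_left (h : z * (1 + ρ) ∈ Ioo (0.995 : ℝ) 1.005) :
    IsBalanced ρ ∧ ¬IsBalanced (1 + 1 / ρ) := by
  have hlo : 0.83 < ρ := by nlinarith [h.1, hz.pos, hz.upper]
  have hhi : ρ < 0.85 := by nlinarith [h.2, hz.pos, hz.lower]
  have hρ : 0 < ρ := by linarith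
  have hinv_lo : 1 < 1 / ρ := by
    rw [lt_div_iff₀ hρ]
    linarith
  have hinv_hi : 1 / ρ < 1.3 := by
    rw [div_lt_iff₀ hρ]
    linarith
  refine ⟨.inl ⟨by linarith, by linarith⟩, ?_⟩
  rintro (⟨-, h'⟩ | ⟨h', -⟩) <;> linarith

theorem isBalanced_of_mid (hρ : 0 < ρ)
    (h : z ^ 3 * (1 + ρ) * (2 + ρ) / ρ ∈ Ioo (0.995 : ℝ) 1.005) :
    IsBalanced ρ ∧ ¬IsBalanced ((1 + ρ) / (2 + ρ)) := by
  have hprod : 0 < (1 + ρ) * (2 + ρ) := by positivity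
  have hlo := (lt_div_iff₀ hρ).1 h.1
  have hhi := (div_lt_iff₀ hρ).1 h.2
  have hquad_lo : 3.18 * ρ < ρ ^ 2 + 2 := by
    nlinarith [mul_lt_mul_of_pos_right hz.cube_upper hprod]
  have hquad_hi : ρ ^ 2 + 2 < 3.258 * ρ := by
    nlinarith [mul_lt_mul_of_pos_right hz.cube_lower hprod]
  have hρ_lo : 0.82 < ρ := by nlinarith
  have hρ_hi : ρ < 2.45 := by nlinarith
  have hratio : (1 + ρ) / (2 + ρ) < 0.82 := by
    rw [div_lt_iff₀ (by linarith)]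
    linarith
  refine ⟨?_, ?_⟩
  · rcases le_total ρ 0.88 with hle | hle
    · exact .inl ⟨hρ_lo.le, hle⟩
    · exact .inr ⟨by nlinarith, by linarith⟩
  · rintro (⟨h', -⟩ | ⟨h', -⟩) <;> linarith

theorem isBalanced_of_right (hρ : 0 < ρ) (h : z ^ 2 * (ρ + 2) / ρ ∈ Ioo (0.995 : ℝ) 1.005) :
    IsBalanced ρ ∧ ¬IsBalanced (ρ + 2) := by
  have hlo := (lt_div_iff₀ hρ).1 h.1
  have hhi := (div_lt_iff₀ hρ).1 h.2
  have hρ_lo : 0.82 < ρ := by nlinarith [hz.sq_lower]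
  have hρ_hi : ρ < 0.88 := by nlinarith [hz.sq_upper]
  refine ⟨.inl ⟨hρ_lo.le, hρ_hi.le⟩, ?_⟩
  rintro (⟨-, h'⟩ | ⟨-, h'⟩) <;> linarith

end IsTribonacciRoot

theorem BranchCylinder.IsChild.isBalanced {F : ℝ → ℝ} {x z : ℝ} {c c' : BranchCylinder F x}
    (hz : IsTribonacciRoot z) (h : IsChild z (z ^ 3) (z ^ 2) c c')
    (hq : c'.density / c.density ∈ Ioo (0.995 : ℝ) 1.005) :
    IsBalanced c.ratio ∧ ¬IsBalanced c'.ratio := by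
  rcases h.density_div_density with ⟨hρ, hd⟩ | ⟨hρ, hd⟩ | ⟨hρ, hd⟩ <;>
    rw [hd] at hq <;> rw [hρ]
  · exact hz.isBalanced_of_left hq
  · exact hz.isBalanced_of_mid c.ratio_pos hq
  · exact hz.isBalanced_of_right c.ratio_pos hq

namespace IsSelfSimilar

variable {z : ℝ} {F : ℝ → ℝ} (hz : IsTribonacciRoot z) (hF : IsSelfSimilar z (z ^ 3) (z ^ 2) F)
include hz hF

theorem eq_zero_of_hasDerivWithinAt {d x : ℝ} (hx : x ∈ Icc (0 : ℝ) 1)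
    (hd : HasDerivWithinAt F d (Icc 0 1) x) : d = 0 := by
  by_contra hne
  obtain ⟨c, hc, hlen⟩ := BranchCylinder.exists_seq_isChild hF hz.pos (pow_pos hz.pos 3)
    (pow_pos hz.pos 2) hx
  have hdens := BranchCylinder.tendsto_density hF.zero hF.one hlen hd
  have hquot : Tendsto (fun n => (c (n + 1)).density / (c n).density) atTop (𝓝 1) := by
    have h := ((tendsto_add_atTop_iff_nat 1).2 hdens).div hdens (abs_ne_zero.2 hne)
    rwa [div_self (abs_ne_zero.2 hne)] at h
  have hnear : ∀ᶠ n in atTop, (c (n + 1)).density / (c n).density ∈ Ioo (0.995 : ℝ) 1.005 :=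
    hquot.eventually_mem (Ioo_mem_nhds (by norm_num) (by norm_num))
  obtain ⟨n, hn, hn'⟩ := (hnear.and ((tendsto_add_atTop_nat 1).eventually hnear)).exists
  exact ((hc n).isBalanced hz hn).2 ((hc (n + 1)).isBalanced hz hn').1

theorem eq_zero_or_eq_top {x : ℝ} (hx : x ∈ Icc (0 : ℝ) 1) {d : EReal}
    (hd : HasExtDerivWithinAt F d (Icc 0 1) x) : d = 0 ∨ d = ⊤ := by
  have : (𝓝[Icc (0 : ℝ) 1 \ {x}] x).NeBot :=
    accPt_principal_iff_nhdsWithin.1 (uniqueDiffOn_Icc zero_lt_one x hx).accPt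
  have hnonneg : 0 ≤ d := by
    refine ge_of_tendsto hd ?_
    filter_upwards [self_mem_nhdsWithin] with y hy
    exact EReal.coe_nonneg.2 (hF.monotoneOn.slope_nonneg hx hy.1)
  induction d with
  | top => exact .inr rfl
  | bot => exact absurd hnonneg (not_le.2 EReal.bot_lt_zero)
  | coe r =>
    have h : HasDerivWithinAt F r (Icc 0 1) x :=
      hasDerivWithinAt_iff_tendsto_slope.2 (EReal.tendsto_coe.1 hd)
    exact .inl (by rw [hF.eq_zero_of_hasDerivWithinAt hz hx h, EReal.coe_zero])

theorem isSingularOn : IsSingularOn F 0 1 where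
  monotone := hF.monotoneOn
  continuous := hF.continuousOn hz.pos (pow_pos hz.pos 3) (pow_pos hz.pos 2)
  lt := by
    rw [hF.zero, hF.one]
    exact one_pos
  deriv := by
    filter_upwards [hF.monotoneOn.ae_differentiableWithinAt measurableSet_Icc,
      ae_restrict_mem measurableSet_Icc] with x hx hmem
    have h := hx.hasDerivWithinAt
    rwa [eq_zero_of_hasDerivWithinAt hz hF hmem h] at h

end IsSelfSimilar

theorem IsSelfSimilar.congr {p q r : ℝ} {F G : ℝ → ℝ} (hF : IsSelfSimilar p q r F)
    (h : EqOn F G (Icc 0 1)) : IsSelfSimilar p q r G where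
  monotoneOn := hF.monotoneOn.congr h
  one := by rw [← h (right_mem_Icc.2 zero_le_one), hF.one]
  left x hx := by rw [← h hx, ← h (mapsTo_leftMap hx), hF.left x hx]
  mid x hx := by rw [← h hx, ← h (mapsTo_midMap hx), hF.mid x hx]
  right x hx := by rw [← h hx, ← h (mapsTo_rightMap hx), hF.right x hx]

theorem isSelfSimilar_oddF {z : ℝ} (hz : IsTribonacciRoot z) :
    IsSelfSimilar z (z ^ 3) (z ^ 2) oddF := by
  obtain ⟨F, hF, hlim⟩ := exists_isSelfSimilar_tendsto_oddDistrib hz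
  exact hF.congr fun x hx => (hlim x hx).limUnder_eq.symm

theorem tendsto_oddDistrib_oddF {x : ℝ} (hx : x ∈ Icc (0 : ℝ) 1) :
    Tendsto (fun n => oddDistrib n x) atTop (𝓝 (oddF x)) := by
  obtain ⟨z, hz⟩ := exists_isTribonacciRoot
  obtain ⟨F, -, hlim⟩ := exists_isSelfSimilar_tendsto_oddDistrib hz
  exact tendsto_nhds_limUnder ⟨F x, hlim x hx⟩

theorem theorem3 :
    (∀ x ∈ Icc (0 : ℝ) 1, Tendsto (fun n : ℕ => oddDistrib n x) atTop (𝓝 (oddF x))) ∧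
    (∀ x ∈ Icc (0 : ℝ) 1, ∀ d : EReal,
      HasExtDerivWithinAt oddF d (Icc 0 1) x → d = 0 ∨ d = ⊤) ∧
    IsSingularOn oddF 0 1 := by
  obtain ⟨z, hz⟩ := exists_isTribonacciRoot
  have hF := isSelfSimilar_oddF hz
  exact ⟨fun _ hx => tendsto_oddDistrib_oddF hx,
    fun _ hx _ hd => IsSelfSimilar.eq_zero_or_eq_top hz hF hx hd, hF.isSingularOn hz⟩
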